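/- Let $u,v,k\ge 0$ be integers with $v+k$ even, and let $a_1,\dots,a_u$, $b_1,\dots,b_v$, $c_1,\dots,c_k$ be positive integers. For $\mathbf x\in\mathbb Z^{2u}$, $\mathbf y\in\mathbb Z^v$, $\mathbf z\in\mathbb Z_{\ge 0}^k$ put $$\mathcal M(\mathbf x,\mathbf y,\mathbf z)=\sum_{i=1}^u a_i(x_{2i-1}^2+x_{2i-1}x_{2i}+x_{2i}^2)+\sum_{i=1}^v b_iy_i^2+\sum_{i=1}^k c_i\frac{z_i(z_i+1)}2 .$$ Every integer $n\ge 0$ has finitely many representations $n=\mathcal M(\mathbf x,\mathbf y,\mathbf z)$; let $r(n)$ be their number. For $\tau$ in the upper half-plane and $q=e^{2\pi i\tau}$ the series $\Phi(\tau)=\sum_{n\ge 0}r(n)q^n$ converges absolutely. Let $\mathbf h=c_1+\cdots+c_k$, $q^{\mathbf h/8}=e^{2\pi i\tau\mathbf h/8}$, $$M=\mathrm{lcm}[4\,\mathrm{lcm}(b_1,\dots,b_v),\,2\,\mathrm{lcm}(c_1,\dots,c_k)],\qquad N_1=\mathrm{lcm}[3\,\mathrm{lcm}(a_1,\dots,a_u),\,M]$$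 (an empty lcm is $1$), and, with Kronecker symbols, $$\chi''=\left(\frac{(-1)^{(v+k)/2}\,4\prod_i b_i\prod_j c_j}{\cdot}\right)\ \text{if } v,k \text{ are even},\qquad \chi''=\left(\frac{(-1)^{(v+k)/2}\,8\prod_i b_i\prod_j c_j}{\cdot}\right)\ \text{if } v,k \text{ are odd}.$$ Let $\omega=\chi''$ if $u$ is even and $\omega=\left(\frac{\cdot}{3}\right)\chi''$ if $u$ is odd. Then the following are equivalent: (i) on the integers coprime to $N_1$, $\omega$ is given by a Dirichlet character modulo $N_1$, and $q^{\mathbf h/8}\Phi(\tau)$ belongs to the space $M_{u+(v+k)/2}(\Gamma_0(N_1),\omega)$ of holomorphic modular forms (holomorphic also at the cusps) of weight $u+(v+k)/2$ with character $\omega$ on $\Gamma_0(N_1)$; (ii) $\mathbf h\equiv 0\pmod 8$. -/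

import Mathlib

open UpperHalfPlane
open scoped MatrixGroups ModularForm Manifold

/-- The Kronecker symbol `(a / n)` for arbitrary integers `a` and `n`: the completely
multiplicative extension in `n` of the Jacobi symbol, with `(a / -1)` the sign of `a`
(where `(0 / -1) = 1`), `(a / 2)` equal to `0`, `1`, `-1` according as `a` is even, `a ≡ ±1 mod 8`,
`a ≡ ±3 mod 8`, and `(a / 0)` equal to `1` if `a = ±1` and to `0` otherwise. -/
def kroneckerSym (a n : ℤ) : ℤ :=
  if n = 0 then (if a.natAbs = 1 then 1 else 0)
  else (if n < 0 ∧ a < 0 then -1 else 1) *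
    ZMod.χ₈ (a : ZMod 8) ^ padicValNat 2 n.natAbs *
    jacobiSym a (n.natAbs / 2 ^ padicValNat 2 n.natAbs)

/-- The space `M_w(Γ₀(N), χ)` of holomorphic modular forms of weight `w` and character `χ` on
`Γ₀(N)`: the functions `f` holomorphic on the upper half-plane such that
`f ((aτ+b)/(cτ+d)) = χ(d) (cτ+d)^w f(τ)` for every matrix `(a b; c d)` in `Γ₀(N)`, and that are
holomorphic at all cusps, i.e. `f ∣[w] γ` is bounded at `i∞` for every `γ` in `SL₂(ℤ)`. -/
def modularFormsWithCharacter (N : ℕ) (w : ℤ) (χ : DirichletCharacter ℂ N) :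
    Submodule ℂ (ℍ → ℂ) where
  carrier := {f | MDifferentiable 𝓘(ℂ) 𝓘(ℂ) f ∧
    (∀ γ ∈ CongruenceSubgroup.Gamma0 N, f ∣[w] γ = χ ((γ 1 1 : ℤ) : ZMod N) • f) ∧
    ∀ γ : SL(2, ℤ), IsBoundedAtImInfty (f ∣[w] γ)}
  zero_mem' := ⟨mdifferentiable_const, fun γ _ => by simp, fun γ => by
    rw [SlashAction.zero_slash]; exact Filter.const_boundedAtFilter _ 0⟩
  add_mem' := fun {f g} hf hg => ⟨hf.1.add hg.1, fun γ hγ => by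
    rw [SlashAction.add_slash, hf.2.1 γ hγ, hg.2.1 γ hγ, smul_add], fun γ => by
    rw [SlashAction.add_slash]; exact (hf.2.2 γ).add (hg.2.2 γ)⟩
  smul_mem' := fun z f hf => ⟨hf.1.const_smul z, fun γ hγ => by
    rw [ModularForm.SL_smul_slash, hf.2.1 γ hγ, smul_comm], fun γ => by
    rw [ModularForm.SL_smul_slash]; exact Filter.BoundedAtFilter.smul z (hf.2.2 γ)⟩

namespace MixedForm

variable {u v k : ℕ}

/-- The mixed form with coefficients `a`, `b`, `c`: the value
`∑ aᵢ (x₂ᵢ₋₁² + x₂ᵢ₋₁ x₂ᵢ + x₂ᵢ²) + ∑ bᵢ yᵢ² + ∑ cᵢ zᵢ(zᵢ+1)/2`.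
The `2u` variables `x` are grouped in the `u` consecutive pairs `x i = (x₂ᵢ₋₁, x₂ᵢ)`. -/
def form (a : Fin u → ℕ) (b : Fin v → ℕ) (c : Fin k → ℕ)
    (x : Fin u → ℤ × ℤ) (y : Fin v → ℤ) (z : Fin k → ℕ) : ℤ :=
  ∑ i, (a i : ℤ) * ((x i).1 ^ 2 + (x i).1 * (x i).2 + (x i).2 ^ 2) +
    ∑ i, (b i : ℤ) * y i ^ 2 +
    ∑ i, (c i : ℤ) * ((z i * (z i + 1) / 2 : ℕ) : ℤ)

/-- The representations of `n` by the mixed form, with `x ∈ ℤ^{2u}`, `y ∈ ℤ^v`, `z ∈ ℕ₀^k`. -/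
def representations (a : Fin u → ℕ) (b : Fin v → ℕ) (c : Fin k → ℕ) (n : ℕ) :
    Set ((Fin u → ℤ × ℤ) × (Fin v → ℤ) × (Fin k → ℕ)) :=
  {p | form a b c p.1 p.2.1 p.2.2 = n}

/-- The nome `q = exp(2πiτ)`. -/
noncomputable def nome (τ : ℍ) : ℂ := Complex.exp (2 * Real.pi * Complex.I * τ)

/-- The generating function `Φ(τ) = ∑ₙ r(n) qⁿ` of the representation numbers `r(n)` of the mixed
form. -/
noncomputable def genFun (a : Fin u → ℕ) (b : Fin v → ℕ) (c : Fin k → ℕ) (τ : ℍ) : ℂ :=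
  ∑' n : ℕ, ((representations a b c n).ncard : ℂ) * nome τ ^ n

/-- `q^{h/8} Φ(τ)`, where `h = c₁ + ⋯ + c_k` and `q^{h/8} = exp(2πiτh/8)`. -/
noncomputable def twistedGenFun (a : Fin u → ℕ) (b : Fin v → ℕ) (c : Fin k → ℕ) (τ : ℍ) : ℂ :=
  Complex.exp (2 * Real.pi * Complex.I * τ * (((∑ i, c i : ℕ) : ℂ) / 8)) * genFun a b c τ

/-- `M = lcm[4 lcm(b₁, …, b_v), 2 lcm(c₁, …, c_k)]`; an empty lcm is `1`. -/
def levelST (b : Fin v → ℕ) (c : Fin k → ℕ) : ℕ :=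
  Nat.lcm (4 * Finset.univ.lcm b) (2 * Finset.univ.lcm c)

/-- `N₁ = lcm[3 lcm(a₁, …, a_u), M]`; an empty lcm is `1`. -/
def level (a : Fin u → ℕ) (b : Fin v → ℕ) (c : Fin k → ℕ) : ℕ :=
  Nat.lcm (3 * Finset.univ.lcm a) (levelST b c)

/-- The values of `χ''`, for `v` and `k` of the same parity: the Kronecker symbol
`(D / ·)` with `D = (-1)^{(v+k)/2} · 4 · ∏ bᵢ ∏ cⱼ` if `v`, `k` are even, and with `8` in place
of `4` if they are odd. -/
def charST (b : Fin v → ℕ) (c : Fin k → ℕ) (d : ℤ) : ℤ :=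
  kroneckerSym ((-1) ^ ((v + k) / 2) * (if Even v then 4 else 8) *
    (∏ i, (b i : ℤ)) * ∏ j, (c j : ℤ)) d

/-- The values of `ω`: `χ''` if `u` is even, `(· / 3) χ''` if `u` is odd. -/
def charMixed (u : ℕ) {v k : ℕ} (b : Fin v → ℕ) (c : Fin k → ℕ) (d : ℤ) : ℤ :=
  if Even u then charST b c d else kroneckerSym d 3 * charST b c d

end MixedForm

/-- The theta constant `∑ exp(πi(n + 1/2)²τ)`. -/
noncomputable def thetaTwo (τ : ℂ) : ℂ :=
  Complex.exp (Real.pi * Complex.I * τ / 4) * jacobiTheta₂ (τ / 2) τ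

/-- The theta constant `∑ exp(πin²τ)`. -/
noncomputable def thetaThree (τ : ℂ) : ℂ := jacobiTheta₂ 0 τ

/-- The theta constant `∑ (-1)ⁿ exp(πin²τ)`. -/
noncomputable def thetaFour (τ : ℂ) : ℂ := jacobiTheta₂ (1 / 2) τ

/-- The primitive eighth root of unity `exp(πi/4)`. -/
noncomputable def zetaEight : ℂ := Complex.exp (Real.pi * Complex.I / 4)

theorem zetaEight_ne_zero : zetaEight ≠ 0 := Complex.exp_ne_zero _

theorem zetaEight_sq : zetaEight ^ (2 : ℤ) = Complex.I := by
  conv_rhs => rw [← Complex.exp_pi_div_two_mul_I]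
  rw [zetaEight, ← Complex.exp_int_mul]
  congr 1; push_cast; ring

theorem zetaEight_four : zetaEight ^ (4 : ℤ) = -1 := by
  rw [show (4 : ℤ) = 2 * 2 by norm_num, zpow_mul, zetaEight_sq]
  exact_mod_cast Complex.I_sq

theorem zetaEight_eight : zetaEight ^ (8 : ℤ) = 1 := by
  rw [show (8 : ℤ) = 4 * 2 by norm_num, zpow_mul, zetaEight_four]; norm_num

theorem zetaEight_zpow_congr {m n : ℤ} (h : m ≡ n [ZMOD 8]) : zetaEight ^ m = zetaEight ^ n := by
  obtain ⟨k, hk⟩ := h.symm.dvd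
  rw [show m = n + 8 * k by linarith, zpow_add₀ zetaEight_ne_zero, zpow_mul, zetaEight_eight]
  simp

theorem hasSum_thetaThree {τ : ℂ} (hτ : 0 < τ.im) :
    HasSum (fun n : ℤ => Complex.exp (Real.pi * Complex.I * τ * (n : ℂ) ^ 2)) (thetaThree τ) := by
  refine (hasSum_jacobiTheta₂_term 0 hτ).congr_fun ?_
  intro n; rw [jacobiTheta₂_term]; congr 1; ring

theorem hasSum_thetaTwo {τ : ℂ} (hτ : 0 < τ.im) :
    HasSum (fun n : ℤ => Complex.exp (Real.pi * Complex.I * τ * ((n : ℂ) + 1 / 2) ^ 2))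
      (thetaTwo τ) := by
  refine ((hasSum_jacobiTheta₂_term (τ / 2) hτ).mul_left _).congr_fun ?_
  intro n; rw [jacobiTheta₂_term, ← Complex.exp_add]; congr 1; ring

theorem cexp_pi_mul_I_mul_int (n : ℤ) : Complex.exp (Real.pi * Complex.I * n) = (-1) ^ n := by
  rw [mul_comm, Complex.exp_int_mul, Complex.exp_pi_mul_I]

theorem hasSum_thetaFour {τ : ℂ} (hτ : 0 < τ.im) :
    HasSum (fun n : ℤ => (-1) ^ n * Complex.exp (Real.pi * Complex.I * τ * (n : ℂ) ^ 2))
      (thetaFour τ) := by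
  refine (hasSum_jacobiTheta₂_term (1 / 2) hτ).congr_fun ?_
  intro n; rw [jacobiTheta₂_term, ← cexp_pi_mul_I_mul_int, ← Complex.exp_add]; congr 1; ring

theorem neg_one_zpow_sq (n : ℤ) : (-1 : ℂ) ^ (n ^ 2) = (-1) ^ n := by
  rcases Int.even_or_odd n with h | h
  · rw [h.neg_one_zpow, (h.pow_of_ne_zero two_ne_zero).neg_one_zpow]
  · rw [h.neg_one_zpow, h.pow.neg_one_zpow]

theorem add_one_im_pos {τ : ℂ} (hτ : 0 < τ.im) : 0 < (τ + 1).im := by simpa using hτ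

theorem thetaThree_add_one {τ : ℂ} (hτ : 0 < τ.im) : thetaThree (τ + 1) = thetaFour τ := by
  refine (hasSum_thetaThree (add_one_im_pos hτ)).unique ((hasSum_thetaFour hτ).congr_fun ?_)
  intro n
  rw [← neg_one_zpow_sq, ← cexp_pi_mul_I_mul_int, ← Complex.exp_add]; congr 1; push_cast; ring

theorem thetaFour_add_one {τ : ℂ} (hτ : 0 < τ.im) : thetaFour (τ + 1) = thetaThree τ := by
  rw [← thetaThree_add_one (add_one_im_pos hτ), thetaThree, thetaThree, add_assoc, one_add_one_eq_two,
    jacobiTheta₂_add_right]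

theorem thetaTwo_add_one {τ : ℂ} (hτ : 0 < τ.im) : thetaTwo (τ + 1) = zetaEight * thetaTwo τ := by
  refine (hasSum_thetaTwo (add_one_im_pos hτ)).unique
    (((hasSum_thetaTwo hτ).mul_left _).congr_fun ?_)
  intro n
  have h : Complex.exp (Real.pi * Complex.I * ((n * (n + 1) : ℤ) : ℂ)) = 1 := by
    rw [cexp_pi_mul_I_mul_int, (Int.even_mul_succ_self n).neg_one_zpow]
  trans zetaEight * Complex.exp (Real.pi * Complex.I * τ * ((n : ℂ) + 1 / 2) ^ 2) *
    Complex.exp (Real.pi * Complex.I * ((n * (n + 1) : ℤ) : ℂ))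
  · rw [zetaEight, ← Complex.exp_add, ← Complex.exp_add]
    congr 1; push_cast; ring
  · rw [h, mul_one]

theorem neg_one_div_im_pos {τ : ℂ} (hτ : 0 < τ.im) : 0 < (-1 / τ).im := by
  have h0 : τ ≠ 0 := by rintro rfl; simp at hτ
  rw [neg_div, Complex.neg_im, one_div, Complex.inv_im, neg_div, neg_neg]
  exact div_pos hτ (Complex.normSq_pos.mpr h0)

theorem neg_I_mul_cpow_half_ne_zero {τ : ℂ} (hτ : 0 < τ.im) :
    (-Complex.I * τ) ^ (1 / 2 : ℂ) ≠ 0 := by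
  have h0 : τ ≠ 0 := by rintro rfl; simp at hτ
  simp [Complex.cpow_eq_zero_iff, h0]

theorem jacobiTheta₂_div_neg_one_div (z : ℂ) {τ : ℂ} (hτ : 0 < τ.im) :
    jacobiTheta₂ (z / τ) (-1 / τ) =
      (-Complex.I * τ) ^ (1 / 2 : ℂ) * Complex.exp (Real.pi * Complex.I * z ^ 2 / τ) *
        jacobiTheta₂ z τ := by
  have h1 := neg_I_mul_cpow_half_ne_zero hτ
  have h2 : Complex.exp (Real.pi * Complex.I * z ^ 2 / τ) *
      Complex.exp (-Real.pi * Complex.I * z ^ 2 / τ) = 1 := by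
    rw [← Complex.exp_add, Complex.exp_eq_one_iff]; exact ⟨0, by ring⟩
  have h3 : (-Complex.I * τ) ^ (1 / 2 : ℂ) * (1 / (-Complex.I * τ) ^ (1 / 2 : ℂ)) = 1 := by
    rw [mul_one_div_cancel h1]
  rw [jacobiTheta₂_functional_equation z τ]
  generalize (-Complex.I * τ) ^ (1 / 2 : ℂ) = s at *
  generalize Complex.exp (Real.pi * Complex.I * z ^ 2 / τ) = e at *
  generalize Complex.exp (-Real.pi * Complex.I * z ^ 2 / τ) = e' at *
  generalize 1 / s = s' at *
  linear_combination (-jacobiTheta₂ (z / τ) (-1 / τ)) * h3 -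
    (jacobiTheta₂ (z / τ) (-1 / τ)) * s * s' * h2

theorem thetaThree_neg_one_div {τ : ℂ} (hτ : 0 < τ.im) :
    thetaThree (-1 / τ) = (-Complex.I * τ) ^ (1 / 2 : ℂ) * thetaThree τ := by
  simpa [thetaThree] using jacobiTheta₂_div_neg_one_div 0 hτ

theorem thetaTwo_neg_one_div {τ : ℂ} (hτ : 0 < τ.im) :
    thetaTwo (-1 / τ) = (-Complex.I * τ) ^ (1 / 2 : ℂ) * thetaFour τ := by
  have h0 : τ ≠ 0 := by rintro rfl; simp at hτ
  have h : Complex.exp (Real.pi * Complex.I * (-1 / τ) / 4) *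
      Complex.exp (Real.pi * Complex.I * (1 / 2) ^ 2 / τ) = 1 := by
    rw [← Complex.exp_add, Complex.exp_eq_one_iff]; exact ⟨0, by ring⟩
  rw [thetaTwo, thetaFour, ← jacobiTheta₂_neg_left, show -(-1 / τ / 2) = 1 / 2 / τ by field_simp,
    jacobiTheta₂_div_neg_one_div _ hτ]
  linear_combination ((-Complex.I * τ) ^ (1 / 2 : ℂ) * jacobiTheta₂ (1 / 2) τ) * h

theorem thetaFour_neg_one_div {τ : ℂ} (hτ : 0 < τ.im) :
    thetaFour (-1 / τ) = (-Complex.I * τ) ^ (1 / 2 : ℂ) * thetaTwo τ := by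
  have h0 : τ ≠ 0 := by rintro rfl; simp at hτ
  have h := jacobiTheta₂_div_neg_one_div (τ / 2) hτ
  rw [show τ / 2 / τ = 1 / 2 by field_simp,
    show Real.pi * Complex.I * (τ / 2) ^ 2 / τ = Real.pi * Complex.I * τ / 4 by
      field_simp; norm_num] at h
  rw [thetaFour, thetaTwo, h, mul_assoc]

/-- The principal square root. -/
noncomputable def csqrt (z : ℂ) : ℂ := z ^ (1 / 2 : ℂ)

theorem csqrt_mul_self (z : ℂ) : csqrt z * csqrt z = z := by
  have := Complex.cpow_nat_inv_pow z two_ne_zero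
  rw [← sq, csqrt, one_div]; exact this

theorem csqrt_mul {z w : ℂ} (hz : z ≠ 0) (hw : w ≠ 0)
    (h : Complex.arg z + Complex.arg w ∈ Set.Ioc (-Real.pi) Real.pi) :
    csqrt (z * w) = csqrt z * csqrt w := by
  rw [csqrt, csqrt, csqrt, Complex.cpow_def_of_ne_zero (mul_ne_zero hz hw),
    Complex.cpow_def_of_ne_zero hz, Complex.cpow_def_of_ne_zero hw,
    (Complex.log_mul_eq_add_log_iff hz hw).mpr h, ← Complex.exp_add, add_mul]

theorem csqrt_mul_of_arg_lt {z w : ℂ} (hz : z ≠ 0) (hw : w ≠ 0)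
    (h1 : Complex.arg z + Complex.arg w - Complex.arg (z * w) < 2 * Real.pi)
    (h2 : -(2 * Real.pi) < Complex.arg z + Complex.arg w - Complex.arg (z * w)) :
    csqrt (z * w) = csqrt z * csqrt w := by
  apply csqrt_mul hz hw
  have h := Complex.arg_mul_coe_angle hz hw
  rw [← Real.Angle.coe_add, Real.Angle.angle_eq_iff_two_pi_dvd_sub] at h
  obtain ⟨k, hk⟩ := h
  have hpi := Real.pi_pos
  have hk0 : k = 0 := by
    have h3 : (-1 : ℝ) < k := by nlinarith
    have h4 : (k : ℝ) < 1 := by nlinarith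
    have h3' : -1 < k := by exact_mod_cast h3
    have h4' : k < 1 := by exact_mod_cast h4
    omega
  rw [hk0] at hk
  have : Complex.arg z + Complex.arg w = Complex.arg (z * w) := by
    simp at hk; linarith
  rw [this]
  exact ⟨Complex.neg_pi_lt_arg _, Complex.arg_le_pi _⟩

theorem thetaThree_add_two {τ : ℂ} : thetaThree (τ + 2) = thetaThree τ :=
  jacobiTheta₂_add_right 0 τ

theorem thetaFour_add_two {τ : ℂ} : thetaFour (τ + 2) = thetaFour τ :=
  jacobiTheta₂_add_right _ τ

theorem thetaTwo_add_two {τ : ℂ} (hτ : 0 < τ.im) :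
    thetaTwo (τ + 2) = Complex.I * thetaTwo τ := by
  rw [← one_add_one_eq_two, ← add_assoc, thetaTwo_add_one (add_one_im_pos hτ), thetaTwo_add_one hτ,
    ← zetaEight_sq, zpow_two, mul_assoc]

theorem ne_zero_of_im_pos {τ : ℂ} (hτ : 0 < τ.im) : τ ≠ 0 := by
  rintro rfl; simp at hτ

theorem two_mul_add_one_ne_zero {τ : ℂ} (hτ : 0 < τ.im) : 2 * τ + 1 ≠ 0 :=
  ne_zero_of_im_pos (by simpa using hτ)

theorem csqrt_neg_I_mul_mul {σ τ : ℂ} (hσ : 0 < σ.im) (hτ : 0 < τ.im) :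
    csqrt (-Complex.I * σ) * csqrt (-Complex.I * τ) = csqrt (-(σ * τ)) := by
  have key : ∀ {τ : ℂ}, 0 < τ.im → |Complex.arg (-Complex.I * τ)| < Real.pi / 2 := fun h =>
    Complex.abs_arg_lt_pi_div_two_iff.mpr (Or.inl (by simpa using h))
  have h1 := abs_lt.mp (key hσ)
  have h2 := abs_lt.mp (key hτ)
  rw [← csqrt_mul (by simp [ne_zero_of_im_pos hσ]) (by simp [ne_zero_of_im_pos hτ])
    ⟨by linarith, by linarith⟩]
  congr 1
  linear_combination σ * τ * Complex.I_sq

/-- The Möbius transformation `τ ↦ τ / (2τ + 1)` as a composition of inversions and a shift. -/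
theorem exists_neg_one_div_eq {τ : ℂ} (hτ : 0 < τ.im) :
    ∃ σ : ℂ, 0 < σ.im ∧ τ / (2 * τ + 1) = -1 / σ ∧ σ + 2 = -1 / τ ∧
      csqrt (-Complex.I * σ) * csqrt (-Complex.I * τ) = csqrt (2 * τ + 1) := by
  have h0 := ne_zero_of_im_pos hτ
  have h1 := two_mul_add_one_ne_zero hτ
  have hσ : 0 < (-1 / τ - 2).im := by simpa using neg_one_div_im_pos hτ
  refine ⟨-1 / τ - 2, hσ, ?_, by ring, ?_⟩
  · have : -1 / τ - 2 = -(2 * τ + 1) / τ := by field_simp; ring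
    rw [this]; field_simp
  · rw [csqrt_neg_I_mul_mul hσ hτ]; congr 1; field_simp; ring

theorem thetaTwo_div_two_mul_add_one {τ : ℂ} (hτ : 0 < τ.im) :
    thetaTwo (τ / (2 * τ + 1)) = csqrt (2 * τ + 1) * thetaTwo τ := by
  obtain ⟨σ, hσ, h1, h2, h3⟩ := exists_neg_one_div_eq hτ
  rw [h1, thetaTwo_neg_one_div hσ, ← thetaFour_add_two, h2, thetaFour_neg_one_div hτ, ← mul_assoc,
    ← h3, csqrt, csqrt]

theorem thetaThree_div_two_mul_add_one {τ : ℂ} (hτ : 0 < τ.im) :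
    thetaThree (τ / (2 * τ + 1)) = csqrt (2 * τ + 1) * thetaThree τ := by
  obtain ⟨σ, hσ, h1, h2, h3⟩ := exists_neg_one_div_eq hτ
  rw [h1, thetaThree_neg_one_div hσ, ← thetaThree_add_two, h2, thetaThree_neg_one_div hτ,
    ← mul_assoc, ← h3, csqrt, csqrt]

theorem thetaFour_div_two_mul_add_one {τ : ℂ} (hτ : 0 < τ.im) :
    thetaFour (τ / (2 * τ + 1)) = -Complex.I * csqrt (2 * τ + 1) * thetaFour τ := by
  obtain ⟨σ, hσ, h1, h2, h3⟩ := exists_neg_one_div_eq hτ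
  have h4 : thetaTwo σ = -Complex.I * thetaTwo (σ + 2) := by
    rw [thetaTwo_add_two hσ]; linear_combination thetaTwo σ * Complex.I_sq
  rw [h1, thetaFour_neg_one_div hσ, h4, h2, thetaTwo_neg_one_div hτ, ← h3, csqrt, csqrt]
  ring

theorem jacobiSym_add_right_cocycle {a b c d : ℤ} (hdet : a * d - b * c = 1) (hc : Even c)
    (hd : 0 < d) (hcd : 0 < c + d) :
    (jacobiSym c (c + d).natAbs : ℂ) * zetaEight ^ (c * (a + 1 + 2 * b)) =
      jacobiSym c d.natAbs := by
  obtain ⟨m, hm⟩ := hc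
  have hdodd : d % 2 = 1 := by
    rcases Int.emod_two_eq_zero_or_one d with h | h
    · obtain ⟨e, he⟩ : (2 : ℤ) ∣ d := Int.dvd_of_emod_eq_zero h
      have : 2 * (a * e - b * m) = 1 := by rw [← hdet, he, hm]; ring
      omega
    · exact h
  obtain ⟨p, hp⟩ : ∃ p : ℕ, d = p := ⟨d.natAbs, by omega⟩
  obtain ⟨q, hq⟩ : ∃ q : ℕ, c + d = q := ⟨(c + d).natAbs, by omega⟩
  have hpodd : Odd p := Nat.odd_iff.mpr (by omega)
  have hqodd : Odd q := Nat.odd_iff.mpr (by omega)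
  have e1 : jacobiSym c q = ZMod.χ₄ q * jacobiSym p q := by
    rw [← jacobiSym.neg _ hqodd]
    apply jacobiSym.mod_left'
    rw [show c = -(p : ℤ) + q by omega, Int.add_emod_right]
  have e2 : jacobiSym q p = jacobiSym c p := by
    apply jacobiSym.mod_left'
    rw [← hq, hp, Int.add_emod_right]
  rw [show (c + d).natAbs = q by omega, show d.natAbs = p by omega, e1]
  have hp4 : p % 4 = 1 ∨ p % 4 = 3 := by omega
  have hq4 : q % 4 = 1 ∨ q % 4 = 3 := by omega
  have one : ∀ e : ℤ, e ≡ 0 [ZMOD 8] → zetaEight ^ e = 1 := fun e he => by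
    rw [zetaEight_zpow_congr he, zpow_zero]
  have neg : ∀ e : ℤ, e ≡ 4 [ZMOD 8] → zetaEight ^ e = -1 := fun e he => by
    rw [zetaEight_zpow_congr he, zetaEight_four]
  have hzero : c % 4 = 0 → zetaEight ^ (c * (a + 1 + 2 * b)) = 1 := fun h => by
    obtain ⟨l, hl⟩ : (4 : ℤ) ∣ c := Int.dvd_of_emod_eq_zero h
    obtain ⟨e, he⟩ : (2 : ℤ) ∣ d - 1 := by omega
    apply one
    apply (Int.modEq_zero_iff_dvd).mpr
    refine ⟨l * (1 + b + 2 * b * l - a * e), ?_⟩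
    have : a = 1 + b * c - 2 * (a * e) := by
      linear_combination hdet - a * he
    rw [hl] at this ⊢
    linear_combination 4 * l * this
  rcases hp4 with h1 | h1 <;> rcases hq4 with h2 | h2
  · rw [ZMod.χ₄_nat_one_mod_four h2, jacobiSym.quadratic_reciprocity_one_mod_four h1 hqodd, e2,
      hzero (by omega)]
    simp
  · rw [ZMod.χ₄_nat_three_mod_four h2, jacobiSym.quadratic_reciprocity_one_mod_four h1 hqodd, e2,
      neg]
    · simp
    obtain ⟨l, hl⟩ : (4 : ℤ) ∣ c - 2 := by omega
    obtain ⟨e, he⟩ : (4 : ℤ) ∣ d - 1 := by omega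
    have : a = 1 + b * c - 4 * (a * e) := by
      linear_combination hdet - a * he
    apply Int.ModEq.symm
    apply Int.modEq_of_dvd
    obtain rfl : c = 4 * l + 2 := by omega
    refine ⟨(2 * l + 1) * (b + b * l - a * e) + l, ?_⟩
    linear_combination (4 * l + 2) * this
  · rw [ZMod.χ₄_nat_one_mod_four h2, jacobiSym.quadratic_reciprocity_one_mod_four' hpodd h2, e2,
      one]
    · simp
    obtain ⟨l, hl⟩ : (4 : ℤ) ∣ c - 2 := by omega
    obtain ⟨e, he⟩ : (4 : ℤ) ∣ d + 1 := by omega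
    have : a = -1 - b * c + 4 * (a * e) := by
      linear_combination -hdet + a * he
    apply (Int.modEq_zero_iff_dvd).mpr
    obtain rfl : c = 4 * l + 2 := by omega
    refine ⟨(2 * l + 1) * (a * e - b * l), ?_⟩
    linear_combination (4 * l + 2) * this
  · rw [ZMod.χ₄_nat_three_mod_four h2, jacobiSym.quadratic_reciprocity_three_mod_four h1 h2, e2,
      hzero (by omega)]
    simp

/-- The transformation law of `θ₂` and `θ₃` under `(a b; c d)` at the point `τ`. -/
def ThetaLaw (a b c d : ℤ) (τ : ℂ) : Prop :=
  thetaTwo ((a * τ + b) / (c * τ + d)) =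
      jacobiSym c d.natAbs * zetaEight ^ (d - 1 + b * d) * csqrt (c * τ + d) * thetaTwo τ ∧
  thetaThree ((a * τ + b) / (c * τ + d)) =
      jacobiSym c d.natAbs * zetaEight ^ (d - 1 + a * b ^ 2 * c) * csqrt (c * τ + d) *
        (if Even b then thetaThree τ else thetaFour τ)

theorem odd_of_det_eq_one {a b c d : ℤ} (hdet : a * d - b * c = 1) (hc : Even c) :
    Odd a ∧ Odd d := by
  have h : Odd (a * d) := by
    rw [show a * d = b * c + 1 by linarith]; exact (hc.mul_left b).add_one
  exact Int.odd_mul.mp h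

theorem thetaLaw_add_one_iff {a b c d : ℤ} (hdet : a * d - b * c = 1) (hc : Even c)
    (hd : 0 < d) (hcd : 0 < c + d) {τ : ℂ} (hτ : 0 < τ.im) :
    ThetaLaw a b c d (τ + 1) ↔ ThetaLaw a (a + b) c (c + d) τ := by
  have hJ := jacobiSym_add_right_cocycle hdet hc hd hcd
  have ha := (odd_of_det_eq_one hdet hc).1
  have e1 : (a * (τ + 1) + b) / (c * (τ + 1) + d) =
      (a * τ + ((a + b : ℤ) : ℂ)) / (c * τ + ((c + d : ℤ) : ℂ)) := by push_cast; congr 1 <;> ring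
  have e2 : (c * (τ + 1) + d : ℂ) = c * τ + ((c + d : ℤ) : ℂ) := by push_cast; ring
  have e3 : zetaEight ^ (c * (a + 1 + 2 * b)) * zetaEight ^ (d - 1 + b * d) * zetaEight =
      zetaEight ^ (c + d - 1 + (a + b) * (c + d)) := by
    rw [← zpow_add₀ zetaEight_ne_zero, ← zpow_add_one₀ zetaEight_ne_zero]
    congr 1
    linear_combination -hdet
  have e4 : zetaEight ^ (c * (a + 1 + 2 * b)) * zetaEight ^ (d - 1 + a * b ^ 2 * c) =
      zetaEight ^ (c + d - 1 + a * (a + b) ^ 2 * c) := by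
    rw [← zpow_add₀ zetaEight_ne_zero]
    apply zetaEight_zpow_congr
    obtain ⟨t, ht⟩ := Int.eight_dvd_sq_sub_one_of_odd ha
    apply Int.modEq_of_dvd
    refine ⟨c * (a + 2 * b) * t, ?_⟩
    linear_combination c * (a + 2 * b) * ht
  rw [ThetaLaw, ThetaLaw, e1, e2, thetaTwo_add_one hτ, thetaThree_add_one hτ, thetaFour_add_one hτ,
    ← hJ, ← e3, ← e4]
  have e5 : (if Even b then thetaFour τ else thetaThree τ) =
      if Even (a + b) then thetaThree τ else thetaFour τ := by
    by_cases hb : Even b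
    · rw [if_pos hb, if_neg (Int.not_even_iff_odd.mpr (ha.add_even hb))]
    · rw [if_neg hb, if_pos (ha.add_odd (Int.not_even_iff_odd.mp hb))]
  rw [e5]
  refine and_congr (Eq.congr_right ?_) (Eq.congr_right ?_) <;> ring

theorem im_div_two_mul_add_one_pos {τ : ℂ} (hτ : 0 < τ.im) : 0 < (τ / (2 * τ + 1)).im := by
  obtain ⟨σ, hσ, h1, -, -⟩ := exists_neg_one_div_eq hτ
  rw [h1]; exact neg_one_div_im_pos hσ

theorem int_linear_im (c d : ℤ) (τ : ℂ) : ((c : ℂ) * τ + d).im = c * τ.im := by simp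

theorem csqrt_cocycle (c : ℤ) {d : ℤ} (hd : 0 < d) {τ : ℂ} (hτ : 0 < τ.im) :
    csqrt (c * (τ / (2 * τ + 1)) + d) * csqrt (2 * τ + 1) =
      csqrt (((c + 2 * d : ℤ) : ℂ) * τ + d) := by
  have h1 := two_mul_add_one_ne_zero hτ
  have hw := im_div_two_mul_add_one_pos hτ
  have hprod : (c * (τ / (2 * τ + 1)) + d) * (2 * τ + 1) = ((c + 2 * d : ℤ) : ℂ) * τ + d := by
    push_cast; linear_combination (c : ℂ) * div_mul_cancel₀ τ h1
  have him := int_linear_im c d (τ / (2 * τ + 1))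
  have him1 : 0 < (2 * τ + 1).im := by simpa using hτ
  have hz : c * (τ / (2 * τ + 1)) + (d : ℂ) ≠ 0 := by
    intro h
    rw [h] at him
    have hc0 : (c : ℝ) = 0 := by
      rcases mul_eq_zero.mp him.symm with h | h
      · exact h
      · exact absurd h hw.ne'
    have : c = 0 := by exact_mod_cast hc0
    rw [this] at h
    simp at h; omega
  have ha1 : 0 < Complex.arg (2 * τ + 1) := by
    refine lt_of_le_of_ne (Complex.arg_nonneg_iff.mpr him1.le) fun h => ?_
    exact him1.ne' (Complex.arg_eq_zero_iff.mp h.symm).2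
  have ha2 : Complex.arg (2 * τ + 1) < Real.pi := Complex.arg_lt_pi_iff.mpr (Or.inr him1.ne')
  have ha3 := Complex.neg_pi_lt_arg (c * (τ / (2 * τ + 1)) + d)
  have ha4 := Complex.arg_le_pi (c * (τ / (2 * τ + 1)) + d)
  rcases lt_or_ge 0 c with hc | hc
  · rw [← csqrt_mul_of_arg_lt hz h1, hprod]
    · rw [hprod]
      have : 0 ≤ Complex.arg (((c + 2 * d : ℤ) : ℂ) * τ + d) := by
        rw [Complex.arg_nonneg_iff, int_linear_im]
        have : (0 : ℝ) ≤ ((c + 2 * d : ℤ) : ℝ) := by exact_mod_cast (by omega)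
        positivity
      linarith
    · have : 0 ≤ Complex.arg (c * (τ / (2 * τ + 1)) + d) := by
        rw [Complex.arg_nonneg_iff, him]
        have : (0 : ℝ) ≤ (c : ℝ) := by exact_mod_cast hc.le
        positivity
      have := Complex.arg_le_pi ((c * (τ / (2 * τ + 1)) + d) * (2 * τ + 1))
      linarith [Real.pi_pos]
  · rw [← csqrt_mul hz h1, hprod]
    have : Complex.arg (c * (τ / (2 * τ + 1)) + d) ≤ 0 := by
      rcases hc.lt_or_eq with hc | rfl
      · refine (Complex.arg_neg_iff.mpr ?_).le
        rw [him]
        exact mul_neg_of_neg_of_pos (by exact_mod_cast hc) hw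
      · refine (Complex.arg_eq_zero_iff.mpr ⟨?_, ?_⟩).le
        · simpa using hd.le
        · simp
    exact ⟨by linarith, by linarith⟩

theorem thetaLaw_div_two_mul_add_one_iff {a b c d : ℤ} (hdet : a * d - b * c = 1) (hc : Even c)
    (hd : 0 < d) {τ : ℂ} (hτ : 0 < τ.im) :
    ThetaLaw a b c d (τ / (2 * τ + 1)) ↔ ThetaLaw (a + 2 * b) b (c + 2 * d) d τ := by
  have h1 := two_mul_add_one_ne_zero hτ
  have hdodd := (odd_of_det_eq_one hdet hc).2
  have e1 : (a * (τ / (2 * τ + 1)) + b) / (c * (τ / (2 * τ + 1)) + d) =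
      (((a + 2 * b : ℤ) : ℂ) * τ + b) / (((c + 2 * d : ℤ) : ℂ) * τ + d) := by
    push_cast
    rw [show (a * (τ / (2 * τ + 1)) + b : ℂ) = ((a + 2 * b) * τ + b) / (2 * τ + 1) by
        rw [eq_div_iff h1]; linear_combination (a : ℂ) * div_mul_cancel₀ τ h1,
      show (c * (τ / (2 * τ + 1)) + d : ℂ) = ((c + 2 * d) * τ + d) / (2 * τ + 1) by
        rw [eq_div_iff h1]; linear_combination (c : ℂ) * div_mul_cancel₀ τ h1,
      div_div_div_cancel_right₀ h1]
  have e2 := csqrt_cocycle c hd hτ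
  have e3 : jacobiSym (c + 2 * d) d.natAbs = jacobiSym c d.natAbs := by
    apply jacobiSym.mod_left'
    rw [Int.natCast_natAbs, abs_of_pos hd, mul_comm, Int.add_mul_emod_self_left]
  obtain ⟨m, hm⟩ := hc
  rw [ThetaLaw, ThetaLaw, e1, ← e2, e3, thetaTwo_div_two_mul_add_one hτ,
    thetaThree_div_two_mul_add_one hτ, thetaFour_div_two_mul_add_one hτ]
  refine and_congr (Eq.congr_right (by ring)) (Eq.congr_right ?_)
  by_cases hb : Even b
  · rw [if_pos hb, if_pos hb]
    have : zetaEight ^ (d - 1 + (a + 2 * b) * b ^ 2 * (c + 2 * d)) =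
        zetaEight ^ (d - 1 + a * b ^ 2 * c) := by
      apply zetaEight_zpow_congr
      obtain ⟨k, hk⟩ := hb
      apply Int.ModEq.symm
      apply Int.modEq_of_dvd
      refine ⟨k ^ 2 * (a * d + b * c + 2 * b * d), ?_⟩
      rw [hk]; ring
    rw [this]; ring
  · rw [if_neg hb, if_neg hb]
    have hbo := Int.not_even_iff_odd.mp hb
    have : zetaEight ^ (d - 1 + (a + 2 * b) * b ^ 2 * (c + 2 * d)) =
        zetaEight ^ (d - 1 + a * b ^ 2 * c) * -Complex.I := by
      have h6 : zetaEight ^ (6 : ℤ) = -Complex.I := by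
        rw [show (6 : ℤ) = 4 + 2 by norm_num, zpow_add₀ zetaEight_ne_zero, zetaEight_four,
          zetaEight_sq, neg_one_mul]
      rw [← h6, ← zpow_add₀ zetaEight_ne_zero]
      apply zetaEight_zpow_congr
      obtain ⟨t, ht⟩ := Int.eight_dvd_sq_sub_one_of_odd hbo
      obtain ⟨k, hk⟩ := hbo
      obtain ⟨e, he⟩ := hdodd
      apply Int.ModEq.symm
      apply Int.modEq_of_dvd
      refine ⟨t * (2 * a * d + 2 * b * c + 4 * b * d) + b * m + (2 * k * e + k + e), ?_⟩
      linear_combination (2 * a * d + 2 * b * c + 4 * b * d) * ht + 2 * hdet + 4 * b * hm +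
        4 * d * hk + 4 * (2 * k + 1) * he
    rw [this]; ring

theorem thetaLaw_zero {a b d : ℤ} (had : a * d = 1) (hd : 0 < d) {τ : ℂ} (hτ : 0 < τ.im) :
    ThetaLaw a b 0 d τ := by
  obtain rfl : d = 1 := by
    rcases Int.eq_one_or_neg_one_of_mul_eq_one' had with h | h <;> omega
  obtain rfl : a = 1 := by omega
  induction b using Int.induction_on generalizing τ with
  | zero => simp [ThetaLaw, csqrt]
  | succ i ih =>
    have := (thetaLaw_add_one_iff (a := 1) (b := i) (c := 0) (d := 1) (by ring) Even.zero
      (by norm_num) (by norm_num) hτ).mp (ih (add_one_im_pos hτ))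
    rwa [add_comm, zero_add] at this
  | pred i ih =>
    have hτ' : 0 < (τ - 1).im := by simpa using hτ
    have := (thetaLaw_add_one_iff (a := 1) (b := -i - 1) (c := 0) (d := 1) (by ring) Even.zero
      (by norm_num) (by norm_num) hτ')
    rw [sub_add_cancel, zero_add, add_sub_cancel] at this
    exact this.mpr (ih hτ')

theorem thetaLaw {a b c d : ℤ} (hdet : a * d - b * c = 1) (hc : Even c) (hd : 0 < d) {τ : ℂ}
    (hτ : 0 < τ.im) : ThetaLaw a b c d τ := by
  induction hn : c.natAbs + d.natAbs using Nat.strong_induction_on generalizing a b c d τ with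
  | _ n ih =>
  have hdodd := (odd_of_det_eq_one hdet hc).2
  obtain ⟨m, hm⟩ := hc
  obtain ⟨e, he⟩ := hdodd
  rcases lt_trichotomy c 0 with h0 | rfl | h0
  · rcases lt_or_gt_of_ne (show -c ≠ d by omega) with h | h
    · have hτ' : 0 < (τ - 1).im := by simpa using hτ
      have := thetaLaw_add_one_iff hdet ⟨m, hm⟩ hd (by omega) hτ'
      rw [sub_add_cancel] at this
      exact this.mpr (ih _ (by omega) (by linear_combination hdet) ⟨m, hm⟩ (by omega) hτ' rfl)
    · have hne : 2 * (-τ) + 1 ≠ 0 := fun h => by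
        have := congrArg Complex.im h
        simp at this; exact hτ.ne' this
      have hne' : 1 - 2 * τ ≠ 0 := by convert hne using 1; ring
      have hτ' : 0 < (τ / (1 - 2 * τ)).im := by
        have h0 := ne_zero_of_im_pos hτ
        have : τ / (1 - 2 * τ) = -1 / (-1 / τ + 2) := by
          have : -1 / τ + 2 = -(1 - 2 * τ) / τ := by field_simp; ring
          rw [this]; field_simp
        rw [this]
        exact neg_one_div_im_pos (by simpa using neg_one_div_im_pos hτ)
      have := thetaLaw_div_two_mul_add_one_iff hdet ⟨m, hm⟩ hd hτ'
      rw [show 2 * (τ / (1 - 2 * τ)) + 1 = 1 / (1 - 2 * τ) by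
        rw [eq_div_iff hne']; linear_combination 2 * div_mul_cancel₀ τ hne',
        div_div_div_cancel_right₀ hne', div_one] at this
      exact this.mpr (ih _ (by omega) (by linear_combination hdet) ⟨m + d, by omega⟩ hd hτ' rfl)
  · exact thetaLaw_zero (by simpa using hdet) hd hτ
  · rcases lt_or_gt_of_ne (show c ≠ d by omega) with h | h
    · have := (thetaLaw_add_one_iff (a := a) (b := b - a) (c := c) (d := d - c)
        (by linear_combination hdet) ⟨m, hm⟩ (by omega) (by omega) hτ).mp
        (ih _ (by omega) (by linear_combination hdet) ⟨m, hm⟩ (by omega) (add_one_im_pos hτ) rfl)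
      rwa [add_sub_cancel, add_sub_cancel] at this
    · have := (thetaLaw_div_two_mul_add_one_iff (a := a - 2 * b) (b := b) (c := c - 2 * d) (d := d)
        (by linear_combination hdet) ⟨m - d, by omega⟩ hd hτ).mp
        (ih _ (by omega) (by linear_combination hdet) ⟨m - d, by omega⟩ hd
          (im_div_two_mul_add_one_pos hτ) rfl)
      rwa [sub_add_cancel, sub_add_cancel] at this

theorem HasSum.mul_complex {ι κ : Type*} {f : ι → ℂ} {g : κ → ℂ} {s t : ℂ} (hf : HasSum f s)
    (hg : HasSum g t) : HasSum (fun p : ι × κ => f p.1 * g p.2) (s * t) :=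
  hf.mul hg (summable_mul_of_summable_norm hf.summable.norm hg.summable.norm)

/-- The theta series `∑ q^(x² + xy + y²)` of the hexagonal lattice, in terms of theta constants. -/
noncomputable def hexTheta (τ : ℂ) : ℂ :=
  thetaThree (2 * τ) * thetaThree (6 * τ) + thetaTwo (2 * τ) * thetaTwo (6 * τ)

theorem natCast_mul_im_pos {m : ℕ} (hm : 0 < m) {τ : ℂ} (hτ : 0 < τ.im) :
    0 < ((m : ℂ) * τ).im := by
  have : (0 : ℝ) < m := by exact_mod_cast hm
  simpa using mul_pos this hτ

theorem HasSum.add_even_odd_snd {f : ℤ × ℤ → ℂ} {s t : ℂ}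
    (hs : HasSum (fun p : ℤ × ℤ => f (p.1 - p.2, 2 * p.2)) s)
    (ht : HasSum (fun p : ℤ × ℤ => f (p.1 - p.2, 2 * p.2 + 1)) t) : HasSum f (s + t) := by
  have he : Function.Injective fun p : ℤ × ℤ => (p.1 - p.2, 2 * p.2) := fun p q h => by
    simp only [Prod.mk.injEq] at h; ext <;> omega
  have ho : Function.Injective fun p : ℤ × ℤ => (p.1 - p.2, 2 * p.2 + 1) := fun p q h => by
    simp only [Prod.mk.injEq] at h; ext <;> omega
  refine HasSum.add_isCompl ⟨?_, ?_⟩ (he.hasSum_range_iff.mpr hs) (ho.hasSum_range_iff.mpr ht)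
  · rw [Set.disjoint_left]
    rintro _ ⟨p, rfl⟩ ⟨q, hq⟩
    simp only [Prod.mk.injEq] at hq; omega
  · rw [codisjoint_iff_le_sup]
    rintro ⟨x, y⟩ -
    rcases Int.even_or_odd' y with ⟨m, rfl | rfl⟩
    · exact Or.inl ⟨(x + m, m), by simp⟩
    · exact Or.inr ⟨(x + m, m), by simp⟩

theorem hasSum_hexTheta {τ : ℂ} (hτ : 0 < τ.im) :
    HasSum (fun p : ℤ × ℤ => Complex.exp (2 * Real.pi * Complex.I * τ *
      ((p.1 : ℂ) ^ 2 + p.1 * p.2 + (p.2 : ℂ) ^ 2))) (hexTheta τ) := by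
  have h2 : 0 < (2 * τ).im := by simpa using hτ
  have h6 : 0 < (6 * τ).im := by simpa using hτ
  have hs := (hasSum_thetaThree h2).mul_complex (hasSum_thetaThree h6)
  have ht := (hasSum_thetaTwo h2).mul_complex (hasSum_thetaTwo h6)
  simp_rw [← Complex.exp_add] at hs ht
  apply HasSum.add_even_odd_snd
  · convert hs using 3
    push_cast; ring
  · convert ht using 3
    push_cast; ring

theorem hasSum_hexTheta' {τ : ℂ} (hτ : 0 < τ.im) :
    HasSum (fun p : ℤ × ℤ => Complex.exp (2 * Real.pi * Complex.I * τ *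
      ((p.1 : ℂ) ^ 2 + p.1 * p.2 + (p.2 : ℂ) ^ 2)))
      ((thetaThree (3 * τ / 2) * thetaThree (τ / 2) +
        thetaFour (3 * τ / 2) * thetaFour (τ / 2)) / 2) := by
  have h1 : 0 < (τ / 2).im := by simpa using hτ
  have h3 : 0 < (3 * τ / 2).im := by simpa using hτ
  let g : ℤ × ℤ → ℤ × ℤ := fun p => (p.2, 2 * p.1 + p.2)
  have hg : Function.Injective g := fun p q h => by
    simp only [g, Prod.mk.injEq] at h; ext <;> omega
  have hs := (((hasSum_thetaThree h3).mul_complex (hasSum_thetaThree h1)).add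
    ((hasSum_thetaFour h3).mul_complex (hasSum_thetaFour h1))).div_const 2
  rw [← hg.hasSum_iff] at hs
  · refine hs.congr_fun ?_
    rintro ⟨x, y⟩
    simp only [Function.comp, g]
    have : (-1 : ℂ) ^ (2 * x + y) = (-1) ^ y := by
      rw [zpow_add₀ (by norm_num), zpow_mul]; norm_num
    rw [this]
    have h4 : ((-1 : ℂ) ^ y) * (-1) ^ y = 1 := by
      rw [← mul_zpow]; norm_num
    have h5 : Complex.exp (2 * Real.pi * Complex.I * τ * ((x : ℂ) ^ 2 + x * y + (y : ℂ) ^ 2)) =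
        Complex.exp (Real.pi * Complex.I * (3 * τ / 2) * (y : ℂ) ^ 2) *
          Complex.exp (Real.pi * Complex.I * (τ / 2) * ((2 * x + y : ℤ) : ℂ) ^ 2) := by
      rw [← Complex.exp_add]; congr 1; push_cast; ring
    rw [h5]
    linear_combination (-Complex.exp (Real.pi * Complex.I * (3 * τ / 2) * (y : ℂ) ^ 2) *
          Complex.exp (Real.pi * Complex.I * (τ / 2) * ((2 * x + y : ℤ) : ℂ) ^ 2) / 2) * h4
  · rintro ⟨n, m⟩ hnm
    have hodd : Odd (n + m) := by
      rw [← Int.not_even_iff_odd]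
      rintro ⟨k, hk⟩
      exact hnm ⟨(k - n, n), by simp only [g, Prod.mk.injEq, true_and]; omega⟩
    have h4 : ((-1 : ℂ) ^ n) * (-1) ^ m = -1 := by
      rw [← zpow_add₀ (by norm_num), hodd.neg_one_zpow]
    simp only
    linear_combination (Complex.exp (Real.pi * Complex.I * (3 * τ / 2) * (n : ℂ) ^ 2) *
          Complex.exp (Real.pi * Complex.I * (τ / 2) * (m : ℂ) ^ 2) / 2) * h4

theorem hexTheta_add_one {τ : ℂ} (hτ : 0 < τ.im) : hexTheta (τ + 1) = hexTheta τ := by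
  have h2 : 0 < (2 * τ).im := by simpa using hτ
  have h6 : 0 < (6 * τ).im := by simpa using hτ
  have h6' : 0 < (6 * τ + 2).im := by simpa using hτ
  have h6'' : 0 < (6 * τ + 2 + 2).im := by simpa using hτ
  rw [hexTheta, hexTheta, show 2 * (τ + 1) = 2 * τ + 2 by ring,
    show 6 * (τ + 1) = 6 * τ + 2 + 2 + 2 by ring, thetaThree_add_two, thetaThree_add_two,
    thetaThree_add_two, thetaThree_add_two, thetaTwo_add_two h2, thetaTwo_add_two h6'',
    thetaTwo_add_two h6', thetaTwo_add_two h6]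
  linear_combination thetaTwo (2 * τ) * thetaTwo (6 * τ) * Complex.I_pow_four

theorem hexTheta_neg_one_div {τ : ℂ} (hτ : 0 < τ.im) :
    hexTheta (-1 / (3 * τ)) = 2 * (csqrt (-Complex.I * (3 * τ / 2)) *
      csqrt (-Complex.I * (τ / 2))) * hexTheta τ := by
  have h1 : 0 < (τ / 2).im := by simpa using hτ
  have h3 : 0 < (3 * τ / 2).im := by simpa using hτ
  have h0 := ne_zero_of_im_pos hτ
  rw [(hasSum_hexTheta hτ).unique (hasSum_hexTheta' hτ), hexTheta,
    show 2 * (-1 / (3 * τ)) = -1 / (3 * τ / 2) by field_simp,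
    show 6 * (-1 / (3 * τ)) = -1 / (τ / 2) by field_simp; norm_num,
    thetaThree_neg_one_div h1, thetaThree_neg_one_div h3, thetaTwo_neg_one_div h1,
    thetaTwo_neg_one_div h3, csqrt, csqrt]
  ring

theorem three_mul_add_one_ne_zero {τ : ℂ} (hτ : 0 < τ.im) : 3 * τ + 1 ≠ 0 :=
  ne_zero_of_im_pos (by simpa using hτ)

theorem hexTheta_div_three_mul_add_one {τ : ℂ} (hτ : 0 < τ.im) :
    0 < (τ / (3 * τ + 1)).im ∧ hexTheta (τ / (3 * τ + 1)) = (3 * τ + 1) * hexTheta τ := by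
  have h0 := ne_zero_of_im_pos hτ
  have h1 := three_mul_add_one_ne_zero hτ
  have h3 : 0 < (3 * τ).im := by simpa using hτ
  obtain ⟨σ, hσ⟩ : ∃ σ, σ = -1 / (3 * τ) - 1 := ⟨_, rfl⟩
  have hσ0 : 0 < σ.im := by rw [hσ]; simpa using neg_one_div_im_pos h3
  have hσ3 : 0 < (3 * σ).im := by simpa using hσ0
  have e1 : 3 * σ * τ = -(3 * τ + 1) := by rw [hσ]; field_simp; ring
  have e2 : τ / (3 * τ + 1) = -1 / (3 * σ) := by
    rw [div_eq_div_iff h1 (ne_zero_of_im_pos hσ3)]; linear_combination e1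
  have half : ∀ {z : ℂ}, 0 < z.im → 0 < (z / 2).im := fun h => by simpa using h
  have hK : csqrt (-Complex.I * (3 * σ / 2)) * csqrt (-Complex.I * (σ / 2)) *
      (csqrt (-Complex.I * (3 * τ / 2)) * csqrt (-Complex.I * (τ / 2))) = (3 * τ + 1) / 4 := by
    have k1 := csqrt_neg_I_mul_mul (half hσ3) (half hτ)
    have k2 := csqrt_neg_I_mul_mul (half hσ0) (half h3)
    rw [show σ / 2 * (3 * τ / 2) = 3 * σ / 2 * (τ / 2) by ring] at k2
    have k3 := csqrt_mul_self (-(3 * σ / 2 * (τ / 2)))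
    rw [mul_comm (csqrt (-Complex.I * (3 * τ / 2))), mul_mul_mul_comm, k1, k2, k3]
    linear_combination -e1 / 4
  refine ⟨by rw [e2]; exact neg_one_div_im_pos hσ3, ?_⟩
  rw [e2, hexTheta_neg_one_div hσ0, ← hexTheta_add_one hσ0, show σ + 1 = -1 / (3 * τ) by
    rw [hσ, sub_add_cancel], hexTheta_neg_one_div hτ]
  linear_combination 4 * hexTheta τ * hK

/-- The transformation law of the hexagonal theta series under `(a b; c d)` at the point `τ`. -/
def HexLaw (a b c d : ℤ) (τ : ℂ) : Prop :=
  hexTheta ((a * τ + b) / (c * τ + d)) = jacobiSym d 3 * (c * τ + d) * hexTheta τ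

theorem hexLaw_add_one_iff {a b c d : ℤ} (hc : 3 ∣ c) {τ : ℂ} (hτ : 0 < τ.im) :
    HexLaw a b c d (τ + 1) ↔ HexLaw a (a + b) c (c + d) τ := by
  have e1 : (a * (τ + 1) + b) / (c * (τ + 1) + d) =
      (a * τ + ((a + b : ℤ) : ℂ)) / (c * τ + ((c + d : ℤ) : ℂ)) := by push_cast; congr 1 <;> ring
  have e2 : (c * (τ + 1) + d : ℂ) = c * τ + ((c + d : ℤ) : ℂ) := by push_cast; ring
  have e3 : jacobiSym (c + d) 3 = jacobiSym d 3 := by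
    apply jacobiSym.mod_left'
    obtain ⟨k, rfl⟩ := hc
    push_cast; omega
  rw [HexLaw, HexLaw, e1, e2, e3, hexTheta_add_one hτ]

theorem hexLaw_div_three_mul_add_one_iff {a b c d : ℤ} {τ : ℂ} (hτ : 0 < τ.im) :
    HexLaw a b c d (τ / (3 * τ + 1)) ↔ HexLaw (a + 3 * b) b (c + 3 * d) d τ := by
  have h1 := three_mul_add_one_ne_zero hτ
  have e2 : (c * (τ / (3 * τ + 1)) + d : ℂ) = ((c + 3 * d) * τ + d) / (3 * τ + 1) := by
    rw [eq_div_iff h1]; linear_combination (c : ℂ) * div_mul_cancel₀ τ h1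
  have e1 : (a * (τ / (3 * τ + 1)) + b) / (c * (τ / (3 * τ + 1)) + d) =
      (((a + 3 * b : ℤ) : ℂ) * τ + b) / (((c + 3 * d : ℤ) : ℂ) * τ + d) := by
    push_cast
    rw [e2, show (a * (τ / (3 * τ + 1)) + b : ℂ) = ((a + 3 * b) * τ + b) / (3 * τ + 1) by
        rw [eq_div_iff h1]; linear_combination (a : ℂ) * div_mul_cancel₀ τ h1,
      div_div_div_cancel_right₀ h1]
  rw [HexLaw, HexLaw, e1, e2, (hexTheta_div_three_mul_add_one hτ).2]
  refine Eq.congr_right ?_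
  push_cast
  field_simp

theorem hexTheta_add_int (b : ℤ) {τ : ℂ} (hτ : 0 < τ.im) : hexTheta (τ + b) = hexTheta τ := by
  induction b using Int.induction_on generalizing τ with
  | zero => simp
  | succ i ih =>
    rw [show τ + ((i + 1 : ℤ) : ℂ) = τ + 1 + (i : ℤ) by push_cast; ring, ih (add_one_im_pos hτ),
      hexTheta_add_one hτ]
  | pred i ih =>
    have hτ' : 0 < (τ - 1).im := by simpa using hτ
    rw [show τ + ((-i - 1 : ℤ) : ℂ) = τ - 1 + (-i : ℤ) by push_cast; ring, ih hτ',
      ← hexTheta_add_one hτ', sub_add_cancel]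

theorem hexLaw {a b c d : ℤ} (hdet : a * d - b * c = 1) (hc : 3 ∣ c) {τ : ℂ}
    (hτ : 0 < τ.im) : HexLaw a b c d τ := by
  induction hn : c.natAbs + d.natAbs using Nat.strong_induction_on generalizing a b c d τ with
  | _ n ih =>
  obtain ⟨m, hm⟩ := hc
  rcases eq_or_ne c 0 with rfl | h0
  · have had : a * d = 1 := by simpa using hdet
    rcases Int.eq_one_or_neg_one_of_mul_eq_one' had with ⟨rfl, rfl⟩ | ⟨rfl, rfl⟩
    · simpa [HexLaw] using hexTheta_add_int b hτ
    · have : jacobiSym (-1) 3 = -1 := by norm_num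
      have e : (-τ + (b : ℂ)) / -1 = τ + ((-b : ℤ) : ℂ) := by push_cast; ring
      have h := hexTheta_add_int (-b) hτ
      rw [← e] at h
      simpa [HexLaw, this] using h
  have hd0 : d ≠ 0 := by
    rintro rfl
    have : 3 * (-b * m) = 1 := by rw [← hdet, hm]; ring
    omega
  rcases lt_or_ge (c.natAbs) (2 * d.natAbs) with h | h
  · by_cases hs : (0 < c ↔ 0 < d)
    · have := (hexLaw_add_one_iff (a := a) (b := b - a) (c := c) (d := d - c) ⟨m, hm⟩ hτ).mp
        (ih _ (by omega) (by linear_combination hdet) ⟨m, hm⟩ (add_one_im_pos hτ) rfl)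
      rwa [add_sub_cancel, add_sub_cancel] at this
    · have hτ' : 0 < (τ - 1).im := by simpa using hτ
      have := hexLaw_add_one_iff (a := a) (b := b) (c := c) (d := d) ⟨m, hm⟩ hτ'
      rw [sub_add_cancel] at this
      exact this.mpr (ih _ (by omega) (by linear_combination hdet) ⟨m, hm⟩ hτ' rfl)
  · by_cases hs : (0 < c ↔ 0 < d)
    · have := (hexLaw_div_three_mul_add_one_iff (a := a - 3 * b) (b := b) (c := c - 3 * d)
        (d := d) hτ).mp (ih _ (by omega) (by linear_combination hdet) ⟨m - d, by omega⟩
          (hexTheta_div_three_mul_add_one hτ).1 rfl)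
      rwa [sub_add_cancel, sub_add_cancel] at this
    · have h3 : 0 < (3 * τ).im := by simpa using hτ
      have hne' : 1 - 3 * τ ≠ 0 := fun h => h3.ne' (by
        have := congrArg Complex.im h
        simp at this; simp [this])
      have hτ' : 0 < (τ / (1 - 3 * τ)).im := by
        have h0 := ne_zero_of_im_pos hτ
        have : τ / (1 - 3 * τ) = -1 / (-1 / τ + 3) := by
          have : -1 / τ + 3 = -(1 - 3 * τ) / τ := by field_simp; ring
          rw [this]; field_simp
        rw [this]
        exact neg_one_div_im_pos (by simpa using neg_one_div_im_pos hτ)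
      have := hexLaw_div_three_mul_add_one_iff (a := a) (b := b) (c := c) (d := d) hτ'
      rw [show 3 * (τ / (1 - 3 * τ)) + 1 = 1 / (1 - 3 * τ) by
        rw [eq_div_iff hne']; linear_combination 3 * div_mul_cancel₀ τ hne',
        div_div_div_cancel_right₀ hne', div_one] at this
      exact this.mpr (ih _ (by omega) (by linear_combination hdet) ⟨m + d, by omega⟩ hτ' rfl)

theorem norm_cexp_pi_mul_I_mul_sq (τ : ℂ) (x : ℝ) :
    ‖Complex.exp (Real.pi * Complex.I * τ * (x : ℂ) ^ 2)‖ =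
      Real.exp (-(Real.pi * τ.im * x ^ 2)) := by
  rw [Complex.norm_exp]
  congr 1
  rw [show (Real.pi : ℂ) * Complex.I * τ * (x : ℂ) ^ 2 =
    ((Real.pi * x ^ 2 : ℝ) : ℂ) * (Complex.I * τ) by push_cast; ring, Complex.re_ofReal_mul]
  simp; ring

theorem norm_cexp_pi_mul_I_mul_sq_le {σ τ : ℂ} (h : σ.im ≤ τ.im) (x : ℝ) :
    ‖Complex.exp (Real.pi * Complex.I * τ * (x : ℂ) ^ 2)‖ ≤
      ‖Complex.exp (Real.pi * Complex.I * σ * (x : ℂ) ^ 2)‖ := by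
  rw [norm_cexp_pi_mul_I_mul_sq, norm_cexp_pi_mul_I_mul_sq]
  gcongr

theorem exists_norm_theta_le {s : ℝ} (hs : 0 < s) :
    ∃ C : ℝ, 0 ≤ C ∧ ∀ τ : ℂ, s ≤ τ.im →
      ‖thetaTwo τ‖ ≤ C ∧ ‖thetaThree τ‖ ≤ C ∧ ‖thetaFour τ‖ ≤ C := by
  have hσ : 0 < (s * Complex.I).im := by simpa using hs
  obtain ⟨A, h2⟩ := (hasSum_thetaTwo hσ).summable.norm
  obtain ⟨B, h3⟩ := (hasSum_thetaThree hσ).summable.norm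
  refine ⟨max A B, (norm_nonneg _).trans (((hasSum_thetaTwo hσ).norm_le_of_bounded h2
    fun _ => le_rfl).trans (le_max_left _ _)), fun τ hτ => ⟨?_, ?_, ?_⟩⟩
  · refine le_trans ?_ (le_max_left _ _)
    refine (hasSum_thetaTwo (hs.trans_le hτ)).norm_le_of_bounded h2 fun n => ?_
    have := norm_cexp_pi_mul_I_mul_sq_le (σ := s * Complex.I) (τ := τ) (by simpa using hτ)
      ((n : ℝ) + 1 / 2)
    push_cast at this
    exact this
  · refine le_trans ?_ (le_max_right _ _)
    refine (hasSum_thetaThree (hs.trans_le hτ)).norm_le_of_bounded h3 fun n => ?_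
    have := norm_cexp_pi_mul_I_mul_sq_le (σ := s * Complex.I) (τ := τ) (by simpa using hτ) (n : ℝ)
    push_cast at this
    exact this
  · refine le_trans ?_ (le_max_right _ _)
    refine (hasSum_thetaFour (hs.trans_le hτ)).norm_le_of_bounded h3 fun n => ?_
    have := norm_cexp_pi_mul_I_mul_sq_le (σ := s * Complex.I) (τ := τ) (by simpa using hτ) (n : ℝ)
    push_cast at this
    rw [norm_mul, norm_zpow, norm_neg, norm_one, one_zpow, one_mul]
    exact this

/-- An `SL₂(ℤ)`-invariant combination of the absolute values of the theta constants. -/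
noncomputable def thetaMass (τ : ℍ) : ℝ :=
  (‖thetaTwo τ‖ ^ 4 + ‖thetaThree τ‖ ^ 4 + ‖thetaFour τ‖ ^ 4) * τ.im

theorem thetaMass_T_smul (τ : ℍ) : thetaMass (ModularGroup.T • τ) = thetaMass τ := by
  have h : ((ModularGroup.T • τ : ℍ) : ℂ) = τ + 1 := by
    rw [modular_T_smul, coe_vadd]; push_cast; ring
  have him : (ModularGroup.T • τ).im = τ.im := by
    rw [modular_T_smul, vadd_im]
  have hζ : ‖zetaEight‖ = 1 := by
    rw [zetaEight, show (Real.pi : ℂ) * Complex.I / 4 = ((Real.pi / 4 : ℝ) : ℂ) * Complex.I by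
      push_cast; ring, Complex.norm_exp_ofReal_mul_I]
  rw [thetaMass, thetaMass, h, him, thetaTwo_add_one τ.im_pos, thetaThree_add_one τ.im_pos,
    thetaFour_add_one τ.im_pos, norm_mul, hζ]
  ring

theorem norm_csqrt_sq (z : ℂ) : ‖csqrt z‖ ^ 2 = ‖z‖ := by
  rw [sq, ← norm_mul, csqrt_mul_self]

theorem thetaMass_S_smul (τ : ℍ) : thetaMass (ModularGroup.S • τ) = thetaMass τ := by
  have h : ((ModularGroup.S • τ : ℍ) : ℂ) = -1 / τ := by
    rw [modular_S_smul]; simp [neg_div, inv_neg]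
  have him : (ModularGroup.S • τ).im = τ.im / ‖(τ : ℂ)‖ ^ 2 := by
    rw [modular_S_smul, ← Complex.normSq_eq_norm_sq]
    change ((-(τ : ℂ))⁻¹).im = _
    rw [Complex.inv_im, Complex.normSq_neg, Complex.neg_im, neg_neg, coe_im]
  have hn : 0 < ‖(τ : ℂ)‖ := norm_pos_iff.mpr (ne_zero_of_im_pos τ.im_pos)
  have hs : ‖(-Complex.I * (τ : ℂ)) ^ (1 / 2 : ℂ)‖ ^ 4 = ‖(τ : ℂ)‖ ^ 2 := by
    have := norm_csqrt_sq (-Complex.I * (τ : ℂ))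
    rw [csqrt] at this
    rw [show 4 = 2 * 2 by norm_num, pow_mul, this]; simp
  rw [thetaMass, thetaMass, h, him, thetaTwo_neg_one_div τ.im_pos, thetaThree_neg_one_div τ.im_pos,
    thetaFour_neg_one_div τ.im_pos, norm_mul, norm_mul, norm_mul, mul_pow, mul_pow, mul_pow, hs]
  field_simp
  ring

theorem thetaMass_smul (γ : SL(2, ℤ)) (τ : ℍ) : thetaMass (γ • τ) = thetaMass τ := by
  have hγ : γ ∈ Subgroup.closure {ModularGroup.S, ModularGroup.T} := by
    rw [SpecialLinearGroup.SL2Z_generators]; trivial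
  induction hγ using Subgroup.closure_induction generalizing τ with
  | mem x hx =>
    rcases hx with rfl | rfl
    · exact thetaMass_S_smul τ
    · exact thetaMass_T_smul τ
  | one => rw [one_smul]
  | mul x y _ _ hx hy => rw [mul_smul, hx, hy]
  | inv x _ hx => rw [← hx (x⁻¹ • τ), smul_inv_smul]

theorem coe_SL_smul (γ : SL(2, ℤ)) (τ : ℍ) :
    ((γ • τ : ℍ) : ℂ) = ((γ 0 0 : ℤ) * (τ : ℂ) + (γ 0 1 : ℤ)) / ((γ 1 0 : ℤ) * τ + (γ 1 1 : ℤ)) := by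
  rw [coe_specialLinearGroup_apply]; simp

theorem im_SL_smul (γ : SL(2, ℤ)) (τ : ℍ) :
    (γ • τ).im = τ.im / ‖((γ 1 0 : ℤ) * (τ : ℂ) + (γ 1 1 : ℤ))‖ ^ 2 := by
  rw [ModularGroup.im_smul_eq_div_normSq, ModularGroup.denom_apply, Complex.normSq_eq_norm_sq]

theorem SL_denom_ne_zero (γ : SL(2, ℤ)) (τ : ℍ) :
    ((γ 1 0 : ℤ) * (τ : ℂ) + (γ 1 1 : ℤ)) ≠ 0 := by
  rw [← ModularGroup.denom_apply]; exact denom_ne_zero _ _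

theorem SL_det (γ : SL(2, ℤ)) : γ 0 0 * γ 1 1 - γ 0 1 * γ 1 0 = 1 := by
  rw [← Matrix.det_fin_two, γ.det_coe]

theorem one_le_norm_int_mul_add {p q : ℤ} (h : p ≠ 0 ∨ q ≠ 0) {τ : ℂ} (hτ : 1 ≤ τ.im) :
    1 ≤ ‖(p : ℂ) * τ + q‖ := by
  by_cases hp : p = 0
  · subst hp
    have hq : q ≠ 0 := by simpa using h
    simp only [Int.cast_zero, zero_mul, zero_add, Complex.norm_intCast]
    exact_mod_cast Int.one_le_abs hq
  · refine le_trans ?_ (Complex.abs_im_le_norm _)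
    rw [int_linear_im, abs_mul, abs_of_pos (zero_lt_one.trans_le hτ)]
    have : (1 : ℝ) ≤ |(p : ℝ)| := by exact_mod_cast Int.one_le_abs hp
    nlinarith

theorem exists_norm_theta_smul_le : ∃ C : ℝ, 0 ≤ C ∧ ∀ (m : ℕ), 0 < m → ∀ (γ : SL(2, ℤ)) (τ : ℍ),
    1 ≤ τ.im →
      ‖thetaTwo (m * (γ • τ : ℍ))‖ ^ 2 ≤ C * ‖((γ 1 0 : ℤ) * (τ : ℂ) + (γ 1 1 : ℤ))‖ ∧
      ‖thetaThree (m * (γ • τ : ℍ))‖ ^ 2 ≤ C * ‖((γ 1 0 : ℤ) * (τ : ℂ) + (γ 1 1 : ℤ))‖ := by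
  obtain ⟨C, hC0, hC⟩ := exists_norm_theta_le (s := 1 / 2) (by norm_num)
  refine ⟨2 * C ^ 2, by positivity, fun m hm γ τ hτ => ?_⟩
  have hm' : (0 : ℝ) < m := by exact_mod_cast hm
  let w : ℍ := ⟨m * (γ • τ : ℍ), natCast_mul_im_pos hm (γ • τ).im_pos⟩
  obtain ⟨g, hg⟩ := ModularGroup.exists_one_half_le_im_smul w
  have hmass := thetaMass_smul g w
  have hgim := im_SL_smul g w
  obtain ⟨h2, h3, h4⟩ := hC (g • w : ℍ) hg
  set j := ‖((γ 1 0 : ℤ) * (τ : ℂ) + (γ 1 1 : ℤ))‖ with hj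
  have hj0 : 0 < j := norm_pos_iff.mpr (SL_denom_ne_zero γ τ)
  have hw : (w : ℂ) = m * (γ • τ : ℍ) := rfl
  have hwim : w.im = m * τ.im / j ^ 2 := by
    have : w.im = m * (γ • τ).im := by
      change (m * ((γ • τ : ℍ) : ℂ)).im = _
      simp
    rw [this, im_SL_smul, mul_div_assoc]
  have hlow : 1 ≤ ‖((g 1 0 : ℤ) * (w : ℂ) + (g 1 1 : ℤ))‖ * j := by
    rw [hj, ← norm_mul]
    have e : ((g 1 0 : ℤ) * (w : ℂ) + (g 1 1 : ℤ)) * ((γ 1 0 : ℤ) * (τ : ℂ) + (γ 1 1 : ℤ)) =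
        ((g 1 0 * m * γ 0 0 + g 1 1 * γ 1 0 : ℤ) : ℂ) * τ +
          ((g 1 0 * m * γ 0 1 + g 1 1 * γ 1 1 : ℤ) : ℂ) := by
      rw [hw, coe_SL_smul]
      push_cast
      have := SL_denom_ne_zero γ τ
      linear_combination ((g 1 0 : ℤ) * m : ℂ) *
        div_mul_cancel₀ ((γ 0 0 : ℤ) * (τ : ℂ) + (γ 0 1 : ℤ)) this
    rw [e]
    apply one_le_norm_int_mul_add _ hτ
    by_contra hcon
    push Not at hcon
    obtain ⟨k1, k2⟩ := hcon
    have hd := SL_det γ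
    have k3 : g 1 0 * m = 0 := by
      linear_combination γ 1 1 * k1 - γ 1 0 * k2 - g 1 0 * m * hd
    have k4 : g 1 1 = 0 := by
      linear_combination γ 0 0 * k2 - γ 0 1 * k1 - g 1 1 * hd
    have k5 : g 1 0 = 0 := by
      rcases mul_eq_zero.mp k3 with h | h
      · exact h
      · omega
    have := SL_det g
    rw [k4, k5] at this
    simp at this
  have hup : (g • w).im ≤ m * τ.im := by
    rw [hgim, hwim, div_div]
    apply div_le_self (by positivity)
    have : (1 : ℝ) ≤ (‖((g 1 0 : ℤ) * (w : ℂ) + (g 1 1 : ℤ))‖ * j) ^ 2 := one_le_pow₀ hlow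
    calc (1 : ℝ) ≤ _ := this
      _ = _ := by ring
  have hbound : (‖thetaTwo w‖ ^ 4 + ‖thetaThree w‖ ^ 4 + ‖thetaFour w‖ ^ 4) ≤
      3 * C ^ 4 * j ^ 2 := by
    have h5 : thetaMass (g • w) ≤ 3 * C ^ 4 * (m * τ.im) := by
      rw [thetaMass]
      have : ‖thetaTwo (g • w : ℍ)‖ ^ 4 + ‖thetaThree (g • w : ℍ)‖ ^ 4 +
          ‖thetaFour (g • w : ℍ)‖ ^ 4 ≤ C ^ 4 + C ^ 4 + C ^ 4 := by gcongr
      calc _ ≤ (C ^ 4 + C ^ 4 + C ^ 4) * (m * τ.im) := by gcongr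
        _ = _ := by ring
    rw [hmass, thetaMass, hwim] at h5
    have hmτ : 0 < m * τ.im := mul_pos hm' τ.im_pos
    rw [← mul_div_assoc, div_le_iff₀ (by positivity)] at h5
    refine le_of_mul_le_mul_right ?_ hmτ
    calc _ ≤ _ := h5
      _ = _ := by ring
  have fin : ∀ x : ℝ, 0 ≤ x → x ^ 4 ≤ 3 * C ^ 4 * j ^ 2 → x ^ 2 ≤ 2 * C ^ 2 * j := by
    intro x hx h
    apply le_of_sq_le_sq _ (by positivity)
    nlinarith [show 0 ≤ C ^ 4 * j ^ 2 by positivity]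
  have p2 : 0 ≤ ‖thetaTwo w‖ ^ 4 := by positivity
  have p3 : 0 ≤ ‖thetaThree w‖ ^ 4 := by positivity
  have p4 : 0 ≤ ‖thetaFour w‖ ^ 4 := by positivity
  exact ⟨fin _ (norm_nonneg _) (by linarith), fin _ (norm_nonneg _) (by linarith)⟩

theorem hasSum_pi_prod {n : ℕ} {α : Type*} {F : Fin n → α → ℂ} {S : Fin n → ℂ}
    (h : ∀ i, HasSum (F i) (S i)) :
    HasSum (fun x : Fin n → α => ∏ i, F i (x i)) (∏ i, S i) := by
  induction n with
  | zero => simp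
  | succ n ih =>
    have := (h 0).mul_complex (ih fun i => h i.succ)
    rw [Fin.prod_univ_succ, ← (Fin.consEquiv fun _ => α).hasSum_iff]
    convert this using 2
    simp [Fin.prod_univ_succ, Fin.consEquiv]

theorem hasSum_nat_thetaTwo {τ : ℂ} (hτ : 0 < τ.im) :
    HasSum (fun n : ℕ => Complex.exp (Real.pi * Complex.I * τ * ((n : ℂ) + 1 / 2) ^ 2))
      (thetaTwo τ / 2) := by
  have h := (hasSum_thetaTwo hτ).nat_add_neg_add_one.div_const 2
  refine h.congr_fun ?_
  intro n
  have : Complex.exp (Real.pi * Complex.I * τ * (((-((n : ℤ) + 1) : ℤ) : ℂ) + 1 / 2) ^ 2) =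
      Complex.exp (Real.pi * Complex.I * τ * (((n : ℤ) : ℂ) + 1 / 2) ^ 2) := by
    congr 1; push_cast; ring
  rw [this]; push_cast; ring

namespace MixedForm

variable {u v k : ℕ}

/-- The product of theta constants that represents the generating function of a mixed form. -/
noncomputable def thetaProd (a : Fin u → ℕ) (b : Fin v → ℕ) (c : Fin k → ℕ) (τ : ℂ) : ℂ :=
  (∏ i, hexTheta (a i * τ)) * (∏ i, thetaThree ((2 * b i : ℕ) * τ)) *
    ∏ i, thetaTwo (c i * τ) / 2

theorem form_nonneg (a : Fin u → ℕ) (b : Fin v → ℕ) (c : Fin k → ℕ)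
    (x : Fin u → ℤ × ℤ) (y : Fin v → ℤ) (z : Fin k → ℕ) : 0 ≤ form a b c x y z := by
  have h1 : ∀ i, 0 ≤ (x i).1 ^ 2 + (x i).1 * (x i).2 + (x i).2 ^ 2 := fun i => by
    nlinarith [sq_nonneg ((x i).1 + (x i).2), sq_nonneg (x i).1, sq_nonneg (x i).2]
  refine add_nonneg (add_nonneg ?_ ?_) ?_ <;> refine Finset.sum_nonneg fun i _ => ?_
  · exact mul_nonneg (by positivity) (h1 i)
  · positivity
  · positivity

theorem term_eq (a : Fin u → ℕ) (b : Fin v → ℕ) (c : Fin k → ℕ) (τ : ℂ)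
    (x : Fin u → ℤ × ℤ) (y : Fin v → ℤ) (z : Fin k → ℕ) :
    (∏ i, Complex.exp (2 * Real.pi * Complex.I * (a i * τ) *
      (((x i).1 : ℂ) ^ 2 + (x i).1 * (x i).2 + ((x i).2 : ℂ) ^ 2))) *
    (∏ i, Complex.exp (Real.pi * Complex.I * ((2 * b i : ℕ) * τ) * (y i : ℂ) ^ 2)) *
    (∏ i, Complex.exp (Real.pi * Complex.I * (c i * τ) * ((z i : ℂ) + 1 / 2) ^ 2)) =
    Complex.exp (2 * Real.pi * Complex.I * τ * (((∑ i, c i : ℕ) : ℂ) / 8)) *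
      Complex.exp (2 * Real.pi * Complex.I * τ * (form a b c x y z : ℂ)) := by
  have hz : ∀ n : ℕ, ((n * (n + 1) / 2 : ℕ) : ℂ) = n * (n + 1) / 2 := fun n => by
    rw [Nat.cast_div (Nat.even_mul_succ_self n).two_dvd (by norm_num)]; push_cast; rfl
  rw [← Complex.exp_sum, ← Complex.exp_sum, ← Complex.exp_sum, ← Complex.exp_add,
    ← Complex.exp_add, ← Complex.exp_add]
  congr 1
  have e3 : ∑ i, Real.pi * Complex.I * (c i * τ) * ((z i : ℂ) + 1 / 2) ^ 2 =
      2 * Real.pi * Complex.I * τ * (((∑ i, c i : ℕ) : ℂ) / 8) + 2 * Real.pi * Complex.I * τ *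
        ((∑ i, (c i : ℤ) * ((z i * (z i + 1) / 2 : ℕ) : ℤ) : ℤ) : ℂ) := by
    rw [Nat.cast_sum, Int.cast_sum, Finset.sum_div, Finset.mul_sum, Finset.mul_sum,
      ← Finset.sum_add_distrib]
    refine Finset.sum_congr rfl fun i _ => ?_
    rw [Int.cast_mul, Int.cast_natCast, Int.cast_natCast, hz]; ring
  have e1 : ∑ i, 2 * Real.pi * Complex.I * (a i * τ) *
      (((x i).1 : ℂ) ^ 2 + (x i).1 * (x i).2 + ((x i).2 : ℂ) ^ 2) = 2 * Real.pi * Complex.I * τ *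
        ((∑ i, (a i : ℤ) * ((x i).1 ^ 2 + (x i).1 * (x i).2 + (x i).2 ^ 2) : ℤ) : ℂ) := by
    rw [Int.cast_sum, Finset.mul_sum]
    refine Finset.sum_congr rfl fun i _ => ?_
    push_cast; ring
  have e2 : ∑ i, Real.pi * Complex.I * ((2 * b i : ℕ) * τ) * (y i : ℂ) ^ 2 =
      2 * Real.pi * Complex.I * τ * ((∑ i, (b i : ℤ) * y i ^ 2 : ℤ) : ℂ) := by
    rw [Int.cast_sum, Finset.mul_sum]
    refine Finset.sum_congr rfl fun i _ => ?_
    push_cast; ring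
  rw [e1, e2, e3, form, Int.cast_add, Int.cast_add]
  ring

theorem hasSum_term (a : Fin u → ℕ) (b : Fin v → ℕ) (c : Fin k → ℕ)
    (ha : ∀ i, 0 < a i) (hb : ∀ i, 0 < b i) (hc : ∀ i, 0 < c i) (τ : ℍ) :
    HasSum (fun p : (Fin u → ℤ × ℤ) × (Fin v → ℤ) × (Fin k → ℕ) =>
      Complex.exp (2 * Real.pi * Complex.I * τ * (((∑ i, c i : ℕ) : ℂ) / 8)) *
        nome τ ^ (form a b c p.1 p.2.1 p.2.2).toNat) (thetaProd a b c τ) := by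
  have h := (hasSum_pi_prod fun i => hasSum_hexTheta (natCast_mul_im_pos (ha i) τ.im_pos)).mul_complex
    ((hasSum_pi_prod fun i => hasSum_thetaThree
      (natCast_mul_im_pos (Nat.mul_pos two_pos (hb i)) τ.im_pos)).mul_complex
    (hasSum_pi_prod fun i => hasSum_nat_thetaTwo (natCast_mul_im_pos (hc i) τ.im_pos)))
  have e : thetaProd a b c τ = _ * (_ * _) := mul_assoc _ _ _
  rw [e]
  refine h.congr_fun ?_
  intro p
  refine Eq.trans ?_ ((term_eq a b c τ p.1 p.2.1 p.2.2).symm.trans (mul_assoc _ _ _))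
  rw [nome, ← Complex.exp_nat_mul]
  congr 2
  have : (((form a b c p.1 p.2.1 p.2.2).toNat : ℤ) : ℂ) = form a b c p.1 p.2.1 p.2.2 := by
    rw [Int.toNat_of_nonneg (form_nonneg ..)]
  rw [Int.cast_natCast] at this
  rw [this]; ring

theorem toNat_form_preimage (a : Fin u → ℕ) (b : Fin v → ℕ) (c : Fin k → ℕ) (n : ℕ) :
    (fun p : (Fin u → ℤ × ℤ) × (Fin v → ℤ) × (Fin k → ℕ) =>
      (form a b c p.1 p.2.1 p.2.2).toNat) ⁻¹' {n} = representations a b c n := by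
  ext p
  have := form_nonneg a b c p.1 p.2.1 p.2.2
  simp only [Set.mem_preimage, Set.mem_singleton_iff, representations, Set.mem_ofPred_eq]
  omega

theorem nome_ne_zero (τ : ℍ) : nome τ ≠ 0 := Complex.exp_ne_zero _

theorem representations_finite (a : Fin u → ℕ) (b : Fin v → ℕ) (c : Fin k → ℕ)
    (ha : ∀ i, 0 < a i) (hb : ∀ i, 0 < b i) (hc : ∀ i, 0 < c i) (n : ℕ) :
    (representations a b c n).Finite := by
  rw [← Set.not_infinite]
  intro hinf
  have := hinf.to_subtype
  have hs := ((hasSum_term a b c ha hb hc UpperHalfPlane.I).summable).subtype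
    (· ∈ representations a b c n)
  have heq : ∀ p : representations a b c n, form a b c p.1.1 p.1.2.1 p.1.2.2 = n := fun p => p.2
  simp only [Function.comp_def, heq, Int.toNat_natCast] at hs
  rw [summable_const_iff] at hs
  exact mul_ne_zero (Complex.exp_ne_zero _) (pow_ne_zero _ (nome_ne_zero _)) hs

theorem hasSum_representations (a : Fin u → ℕ) (b : Fin v → ℕ) (c : Fin k → ℕ)
    (ha : ∀ i, 0 < a i) (hb : ∀ i, 0 < b i) (hc : ∀ i, 0 < c i) (τ : ℍ) :
    HasSum (fun n : ℕ =>
      Complex.exp (2 * Real.pi * Complex.I * τ * (((∑ i, c i : ℕ) : ℂ) / 8)) *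
        (((representations a b c n).ncard : ℂ) * nome τ ^ n)) (thetaProd a b c τ) := by
  have h := (hasSum_term a b c ha hb hc τ).tsum_fiberwise
    (fun p => (form a b c p.1 p.2.1 p.2.2).toNat)
  refine h.congr_fun ?_
  intro n
  rw [toNat_form_preimage]
  have heq : ∀ p : representations a b c n, form a b c p.1.1 p.1.2.1 p.1.2.2 = n := fun p => p.2
  simp only [heq, Int.toNat_natCast]
  rw [tsum_const, nsmul_eq_mul, Nat.card_coe_set_eq]
  ring

theorem summable_representations (a : Fin u → ℕ) (b : Fin v → ℕ) (c : Fin k → ℕ)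
    (ha : ∀ i, 0 < a i) (hb : ∀ i, 0 < b i) (hc : ∀ i, 0 < c i) (τ : ℍ) :
    Summable fun n : ℕ => ((representations a b c n).ncard : ℂ) * nome τ ^ n :=
  (summable_mul_left_iff (Complex.exp_ne_zero _)).mp
    (hasSum_representations a b c ha hb hc τ).summable

theorem twistedGenFun_eq_thetaProd (a : Fin u → ℕ) (b : Fin v → ℕ) (c : Fin k → ℕ)
    (ha : ∀ i, 0 < a i) (hb : ∀ i, 0 < b i) (hc : ∀ i, 0 < c i) (τ : ℍ) :
    twistedGenFun a b c τ = thetaProd a b c τ := by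
  rw [twistedGenFun, genFun, ← tsum_mul_left]
  exact (hasSum_representations a b c ha hb hc τ).tsum_eq

end MixedForm

theorem kroneckerSym_of_odd (a : ℤ) {n : ℤ} (hn : Odd n) :
    kroneckerSym a n = (if n < 0 ∧ a < 0 then -1 else 1) * jacobiSym a n.natAbs := by
  have h0 : n ≠ 0 := by rintro rfl; simp at hn
  have hp : padicValNat 2 n.natAbs = 0 := by
    apply padicValNat.eq_zero_of_not_dvd
    rw [← even_iff_two_dvd, Int.natAbs_even, Int.not_even_iff_odd]
    exact hn
  rw [kroneckerSym, if_neg h0, hp]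
  simp

theorem kroneckerSym_of_odd_of_pos (a : ℤ) {n : ℤ} (hn : Odd n) (hpos : 0 < n) :
    kroneckerSym a n = jacobiSym a n.natAbs := by
  rw [kroneckerSym_of_odd a hn, if_neg (by omega), one_mul]

theorem kroneckerSym_neg_right (a : ℤ) {n : ℤ} (hn : Odd n) (hpos : 0 < n) :
    kroneckerSym a (-n) = (if a < 0 then -1 else 1) * kroneckerSym a n := by
  rw [kroneckerSym_of_odd a hn.neg, kroneckerSym_of_odd_of_pos a hn hpos, Int.natAbs_neg]
  simp [hpos]

theorem kroneckerSym_mul_right (a : ℤ) {m n : ℤ} (hm : Odd m) (hn : Odd n) :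
    kroneckerSym a (m * n) = kroneckerSym a m * kroneckerSym a n := by
  have hm0 : m ≠ 0 := by rintro rfl; simp at hm
  have hn0 : n ≠ 0 := by rintro rfl; simp at hn
  rw [kroneckerSym_of_odd a (hm.mul hn), kroneckerSym_of_odd a hm, kroneckerSym_of_odd a hn,
    Int.natAbs_mul, jacobiSym.mul_right' _ (by omega) (by omega)]
  by_cases ha : a < 0
  · rcases lt_or_gt_of_ne hm0 with h1 | h1 <;> rcases lt_or_gt_of_ne hn0 with h2 | h2
    · simp [ha, h1, h2, not_lt.mpr (mul_pos_of_neg_of_neg h1 h2).le]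
    · simp [ha, h1, not_lt.mpr h2.le, mul_neg_of_neg_of_pos h1 h2]
    · simp [ha, not_lt.mpr h1.le, h2, mul_neg_of_pos_of_neg h1 h2]
    · simp [ha, not_lt.mpr h1.le, not_lt.mpr h2.le, not_lt.mpr (mul_pos h1 h2).le]
  · simp [ha]

theorem kroneckerSym_three (d : ℤ) : kroneckerSym d 3 = jacobiSym d 3 :=
  kroneckerSym_of_odd_of_pos d (by decide) (by norm_num)

theorem jacobiSym_prod_left {ι : Type*} (s : Finset ι) (f : ι → ℤ) (n : ℕ) :
    jacobiSym (∏ i ∈ s, f i) n = ∏ i ∈ s, jacobiSym (f i) n := by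
  classical
  induction s using Finset.induction_on with
  | empty => simp
  | insert i s hi ih => rw [Finset.prod_insert hi, Finset.prod_insert hi, jacobiSym.mul_left, ih]

section Scaled

variable {p q r s : ℤ} {m : ℕ} {τ : ℂ}

theorem natCast_mul_moebius {r' : ℤ} (hr : r = m * r') :
    (m : ℂ) * ((p * τ + q) / (r * τ + s)) =
      (p * (m * τ) + ((q * m : ℤ) : ℂ)) / (r' * (m * τ) + s) := by
  rw [hr, ← mul_div_assoc]; push_cast; congr 1 <;> ring

theorem hexTheta_natCast_mul_moebius (hdet : p * s - q * r = 1) (hm : 0 < m)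
    (hr : ((3 * m : ℕ) : ℤ) ∣ r) (hτ : 0 < τ.im) :
    hexTheta (m * ((p * τ + q) / (r * τ + s))) =
      jacobiSym s 3 * (r * τ + s) * hexTheta (m * τ) := by
  obtain ⟨t, ht⟩ := hr
  have hr' : r = m * (3 * t) := by rw [ht]; push_cast; ring
  have := hexLaw (a := p) (b := q * m) (c := 3 * t) (d := s) (by rw [← hdet, hr']; ring) ⟨t, rfl⟩
    (natCast_mul_im_pos hm hτ)
  rw [natCast_mul_moebius hr', this, hr']
  push_cast; ring

theorem jacobiSym_mul_of_sq (m : ℤ) (r : ℤ) {n : ℕ} (h : IsCoprime m n) :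
    jacobiSym (m * (m * r)) n = jacobiSym r n := by
  rw [← mul_assoc, ← sq, jacobiSym.mul_left, jacobiSym.sq_one' (Int.isCoprime_iff_gcd_eq_one.mp h),
    one_mul]

theorem gcd_natAbs_eq_one {m n : ℤ} (h : IsCoprime m n) : m.gcd n.natAbs = 1 := by
  rw [Int.isCoprime_iff_gcd_eq_one] at h
  rwa [Int.gcd, Int.natAbs_natCast]

theorem isCoprime_natAbs_of_det {r' : ℤ} (hdet : p * s - q * r = 1) (hr : r = m * r') :
    IsCoprime (m : ℤ) s.natAbs := by
  rw [Int.isCoprime_iff_gcd_eq_one]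
  exact gcd_natAbs_eq_one ⟨-q * r', p, by rw [← hdet, hr]; ring⟩

theorem thetaTwo_natCast_mul_moebius (hdet : p * s - q * r = 1) (hm : 0 < m) (hs : 0 < s)
    (hr : ((2 * m : ℕ) : ℤ) ∣ r) (hτ : 0 < τ.im) :
    thetaTwo (m * ((p * τ + q) / (r * τ + s))) =
      jacobiSym (m * r) s.natAbs * (zetaEight ^ (s - 1) * csqrt (r * τ + s)) *
        zetaEight ^ (q * s * m) * thetaTwo (m * τ) := by
  obtain ⟨t, ht⟩ := hr
  have hr' : r = m * (2 * t) := by rw [ht]; push_cast; ring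
  have := (thetaLaw (a := p) (b := q * m) (c := 2 * t) (d := s) (by rw [← hdet, hr']; ring)
    (even_two_mul t) hs (natCast_mul_im_pos hm hτ)).1
  have e : ((2 * t : ℤ) : ℂ) * (m * τ) + s = r * τ + s := by rw [hr']; push_cast; ring
  rw [natCast_mul_moebius hr', this, e]
  conv_rhs => rw [hr']
  rw [jacobiSym_mul_of_sq _ _ (isCoprime_natAbs_of_det hdet hr'), zpow_add₀ zetaEight_ne_zero,
    show q * m * s = q * s * m by ring, ← hr']
  ring

theorem thetaThree_natCast_mul_moebius (hdet : p * s - q * r = 1) (hm : 0 < m) (hs : 0 < s)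
    (hr : ((4 * m : ℕ) : ℤ) ∣ r) (hτ : 0 < τ.im) :
    thetaThree ((2 * m : ℕ) * ((p * τ + q) / (r * τ + s))) =
      jacobiSym (2 * m * r) s.natAbs * (zetaEight ^ (s - 1) * csqrt (r * τ + s)) *
        thetaThree ((2 * m : ℕ) * τ) := by
  obtain ⟨t, ht⟩ := hr
  have hr' : r = (2 * m : ℕ) * (2 * t) := by rw [ht]; push_cast; ring
  have := (thetaLaw (a := p) (b := q * (2 * m : ℕ)) (c := 2 * t) (d := s)
    (by rw [← hdet, hr']; ring)
    (even_two_mul t) hs (natCast_mul_im_pos (Nat.mul_pos two_pos hm) hτ)).2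
  have e : ((2 * t : ℤ) : ℂ) * ((2 * m : ℕ) * τ) + s = r * τ + s := by rw [hr']; push_cast; ring
  have e8 : zetaEight ^ (s - 1 + p * (q * (2 * m : ℕ)) ^ 2 * (2 * t)) = zetaEight ^ (s - 1) := by
    apply zetaEight_zpow_congr
    apply Int.ModEq.symm
    apply Int.modEq_of_dvd
    exact ⟨p * q ^ 2 * m ^ 2 * t, by push_cast; ring⟩
  have e2 : jacobiSym (2 * m * r) s.natAbs = jacobiSym (2 * t) s.natAbs := by
    rw [← jacobiSym_mul_of_sq _ (2 * t) (isCoprime_natAbs_of_det hdet hr'), ← hr']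
    push_cast; rfl
  rw [natCast_mul_moebius hr', this, e, e8, e2,
    if_pos ((even_iff_two_dvd.mpr ⟨m, by push_cast; rfl⟩ : Even ((2 * m : ℕ) : ℤ)).mul_left q)]
  ring

end Scaled

namespace MixedForm

variable {u v k : ℕ} {a : Fin u → ℕ} {b : Fin v → ℕ} {c : Fin k → ℕ}

theorem three_mul_dvd_level (i : Fin u) : 3 * a i ∣ level a b c :=
  (mul_dvd_mul_left 3 (Finset.dvd_lcm (Finset.mem_univ i))).trans (Nat.dvd_lcm_left _ _)

theorem levelST_dvd_level : levelST b c ∣ level a b c := Nat.dvd_lcm_right _ _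

theorem four_mul_dvd_level (i : Fin v) : 4 * b i ∣ level a b c :=
  ((mul_dvd_mul_left 4 (Finset.dvd_lcm (Finset.mem_univ i))).trans (Nat.dvd_lcm_left _ _)).trans
    levelST_dvd_level

theorem two_mul_dvd_level (i : Fin k) : 2 * c i ∣ level a b c :=
  ((mul_dvd_mul_left 2 (Finset.dvd_lcm (Finset.mem_univ i))).trans (Nat.dvd_lcm_right _ _)).trans
    levelST_dvd_level

theorem four_dvd_level : 4 ∣ level a b c :=
  ((dvd_mul_right 4 _).trans (Nat.dvd_lcm_left _ _)).trans levelST_dvd_level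

theorem three_dvd_level : 3 ∣ level a b c :=
  (dvd_mul_right 3 _).trans (Nat.dvd_lcm_left _ _)

theorem level_ne_zero (ha : ∀ i, 0 < a i) (hb : ∀ i, 0 < b i) (hc : ∀ i, 0 < c i) :
    level a b c ≠ 0 := by
  have key : ∀ {n : ℕ} {f : Fin n → ℕ}, (∀ i, 0 < f i) → Finset.univ.lcm f ≠ 0 := fun h => by
    rw [Ne, Finset.lcm_eq_zero_iff]
    rintro ⟨i, -, hi⟩
    exact (h i).ne' hi
  exact Nat.lcm_ne_zero (mul_ne_zero (by norm_num) (key ha))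
    (Nat.lcm_ne_zero (mul_ne_zero (by norm_num) (key hb)) (mul_ne_zero (by norm_num) (key hc)))

theorem odd_of_isCoprime_level {d : ℤ} (h : IsCoprime d (level a b c : ℤ)) : Odd d := by
  rw [← Int.not_even_iff_odd]
  intro he
  have h2 : (2 : ℤ) ∣ level a b c := by
    exact_mod_cast (show 2 ∣ 4 by norm_num).trans (four_dvd_level (a := a) (b := b) (c := c))
  have := h.isUnit_of_dvd' he.two_dvd h2
  norm_num [Int.isUnit_iff] at this

theorem charST_of_pos (hvk : Even (v + k)) {s : ℤ} (hs : Odd s) (hpos : 0 < s) :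
    charST b c s = jacobiSym (-1) s.natAbs ^ ((v + k) / 2) * jacobiSym 2 s.natAbs ^ v *
      (∏ i, jacobiSym (b i) s.natAbs) * ∏ j, jacobiSym (c j) s.natAbs := by
  rw [charST, kroneckerSym_of_odd_of_pos _ hs hpos, jacobiSym.mul_left, jacobiSym.mul_left,
    jacobiSym.mul_left, jacobiSym_prod_left, jacobiSym_prod_left, jacobiSym.pow_left]
  have h2 : jacobiSym 2 s.natAbs ^ 2 = 1 := by
    apply jacobiSym.sq_one
    apply gcd_natAbs_eq_one
    obtain ⟨l, hl⟩ := hs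
    exact ⟨-l, 1, by rw [hl]; ring⟩
  congr 3
  split_ifs with hv
  · obtain ⟨l, rfl⟩ := hv
    rw [← two_mul, pow_mul, h2, one_pow, show (4 : ℤ) = 2 ^ 2 by norm_num, jacobiSym.pow_left, h2]
  · obtain ⟨l, rfl⟩ := Nat.not_even_iff_odd.mp hv
    rw [pow_succ, pow_mul, h2, one_pow, show (8 : ℤ) = 2 ^ 2 * 2 by norm_num, jacobiSym.mul_left,
      jacobiSym.pow_left, h2]

theorem zetaEight_sub_one_sq {s : ℤ} (hs : Odd s) (hpos : 0 < s) :
    (zetaEight ^ (s - 1)) ^ 2 = (jacobiSym (-1) s.natAbs : ℂ) := by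
  have hodd : Odd s.natAbs := Int.natAbs_odd.mpr hs
  rw [jacobiSym.at_neg_one hodd, ZMod.χ₄_nat_eq_if_mod_four, if_neg (by
    rw [← Nat.even_iff]; exact Nat.not_even_iff_odd.mpr hodd), ← zpow_natCast, ← zpow_mul]
  obtain ⟨l, hl⟩ := hs
  split_ifs with h
  · rw [zetaEight_zpow_congr (n := 0), zpow_zero]
    · simp
    · exact Int.modEq_zero_iff_dvd.mpr ⟨l / 2, by push_cast; omega⟩
  · rw [zetaEight_zpow_congr (n := 4), zetaEight_four]
    · simp
    · exact (Int.modEq_of_dvd ⟨l / 2, by push_cast; omega⟩).symm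

theorem thetaProd_moebius_of_pos (hvk : Even (v + k)) (ha : ∀ i, 0 < a i) (hb : ∀ i, 0 < b i)
    (hc : ∀ i, 0 < c i) (h8 : 8 ∣ ∑ i, c i) {p q r s : ℤ} (hdet : p * s - q * r = 1) (hs : 0 < s)
    (hr : (level a b c : ℤ) ∣ r) {τ : ℂ} (hτ : 0 < τ.im) :
    thetaProd a b c ((p * τ + q) / (r * τ + s)) =
      charMixed u b c s * (r * τ + s) ^ (u + (v + k) / 2) * thetaProd a b c τ := by
  have hdvd : ∀ {n : ℕ}, n ∣ level a b c → (n : ℤ) ∣ r := fun h =>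
    (Int.natCast_dvd_natCast.mpr h).trans hr
  have hodd : Odd s := by
    apply (odd_of_det_eq_one hdet _).2
    exact (even_iff_two_dvd.mpr ((show (2 : ℤ) ∣ (4 : ℕ) by norm_num).trans (hdvd four_dvd_level)))
  have e1 : ∏ i, hexTheta (a i * ((p * τ + q) / (r * τ + s))) =
      (jacobiSym s 3 * (r * τ + s)) ^ u * ∏ i, hexTheta (a i * τ) := by
    rw [← Fin.prod_const, ← Finset.prod_mul_distrib]
    exact Finset.prod_congr rfl fun i _ =>
      hexTheta_natCast_mul_moebius hdet (ha i) (hdvd (three_mul_dvd_level i)) hτ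
  set ε := zetaEight ^ (s - 1) * csqrt (r * τ + s) with hε
  have e2 : ∏ i, thetaThree ((2 * b i : ℕ) * ((p * τ + q) / (r * τ + s))) =
      (jacobiSym (2 * r) s.natAbs * ε) ^ v * (∏ i, (jacobiSym (b i) s.natAbs : ℂ)) *
        ∏ i, thetaThree ((2 * b i : ℕ) * τ) := by
    rw [← Fin.prod_const, ← Finset.prod_mul_distrib, ← Finset.prod_mul_distrib]
    refine Finset.prod_congr rfl fun i _ => ?_
    rw [thetaThree_natCast_mul_moebius hdet (hb i) hs (hdvd (four_mul_dvd_level i)) hτ,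
      show (2 * b i * r : ℤ) = 2 * r * b i by ring, jacobiSym.mul_left (2 * r)]
    push_cast; ring
  have e3 : ∏ i, thetaTwo (c i * ((p * τ + q) / (r * τ + s))) / 2 =
      (jacobiSym r s.natAbs * ε) ^ k * (∏ i, (jacobiSym (c i) s.natAbs : ℂ)) *
        ∏ i, thetaTwo (c i * τ) / 2 := by
    have hζ : ∏ i, zetaEight ^ (q * s * c i) = 1 := by
      have : ∀ t : Finset (Fin k), ∏ i ∈ t, zetaEight ^ (q * s * c i) =
          zetaEight ^ (q * s * ((∑ i ∈ t, c i : ℕ) : ℤ)) := fun t => by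
        classical
        induction t using Finset.induction_on with
        | empty => simp
        | insert i t hi ih =>
          rw [Finset.prod_insert hi, Finset.sum_insert hi, ih, ← zpow_add₀ zetaEight_ne_zero]
          congr 1; push_cast; ring
      rw [this, zetaEight_zpow_congr (n := 0), zpow_zero]
      exact Int.modEq_zero_iff_dvd.mpr ((Int.natCast_dvd_natCast.mpr h8).mul_left _)
    rw [← mul_one ((jacobiSym r s.natAbs * ε) ^ k), ← hζ, ← Fin.prod_const,
      ← Finset.prod_mul_distrib, ← Finset.prod_mul_distrib, ← Finset.prod_mul_distrib]
    refine Finset.prod_congr rfl fun i _ => ?_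
    rw [thetaTwo_natCast_mul_moebius hdet (hc i) hs (hdvd (two_mul_dvd_level i)) hτ,
      jacobiSym.mul_left]
    push_cast; ring
  have hr1 : jacobiSym r s.natAbs ^ 2 = 1 := by
    exact jacobiSym.sq_one (gcd_natAbs_eq_one ⟨-q, p, by rw [← hdet]; ring⟩)
  have hε2 : ε ^ 2 = jacobiSym (-1) s.natAbs * (r * τ + s) := by
    rw [hε, mul_pow, zetaEight_sub_one_sq hodd hs, sq (csqrt _), csqrt_mul_self]
  obtain ⟨w, hw⟩ := hvk
  have hw2 : (v + k) / 2 = w := by omega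
  have hrε : ((jacobiSym r s.natAbs : ℂ) * ε) ^ (v + k) =
      (jacobiSym (-1) s.natAbs) ^ w * (r * τ + s) ^ w := by
    have hr1' : (jacobiSym r s.natAbs : ℂ) ^ 2 = 1 := by exact_mod_cast hr1
    rw [hw, ← two_mul, pow_mul, mul_pow, hr1', hε2, one_mul, mul_pow]
  have hchar : (charMixed u b c s : ℂ) = jacobiSym s 3 ^ u * charST b c s := by
    have h3 : jacobiSym s 3 ^ 2 = 1 := by
      apply jacobiSym.sq_one
      have : IsCoprime s r := ⟨p, -q, by rw [← hdet]; ring⟩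
      have := this.of_isCoprime_of_dvd_right (hdvd three_dvd_level)
      exact Int.isCoprime_iff_gcd_eq_one.mp this
    rw [charMixed, kroneckerSym_three]
    split_ifs with hu
    · obtain ⟨l, rfl⟩ := hu
      rw [← Int.cast_pow, ← two_mul, pow_mul, h3]; simp
    · obtain ⟨l, rfl⟩ := Nat.not_even_iff_odd.mp hu
      rw [← Int.cast_pow, pow_succ, pow_mul, h3]; simp
  rw [thetaProd, thetaProd, e1, e2, e3, hchar, charST_of_pos ⟨w, hw⟩ hodd hs, hw2,
    jacobiSym.mul_left 2]
  simp only [Int.cast_mul, Int.cast_pow, Int.cast_prod]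
  rw [pow_add] at hrε
  clear_value ε
  generalize (r * τ + s : ℂ) = J at *
  linear_combination (jacobiSym s 3 * J) ^ u * (∏ i, hexTheta (a i * τ)) *
    (jacobiSym 2 s.natAbs : ℂ) ^ v * (∏ i, (jacobiSym (b i) s.natAbs : ℂ)) *
    (∏ i, thetaThree ((2 * b i : ℕ) * τ)) * (∏ i, (jacobiSym (c i) s.natAbs : ℂ)) *
    (∏ i, thetaTwo (c i * τ) / 2) * hrε

end MixedForm

namespace MixedForm

variable {u v k : ℕ} {a : Fin u → ℕ} {b : Fin v → ℕ} {c : Fin k → ℕ}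

theorem charMixed_neg (hb : ∀ i, 0 < b i) (hc : ∀ i, 0 < c i) {s : ℤ} (hs : Odd s) (hpos : 0 < s) :
    charMixed u b c (-s) = (-1) ^ (u + (v + k) / 2) * charMixed u b c s := by
  have h3 : jacobiSym (-s) 3 = -jacobiSym s 3 := by
    rw [jacobiSym.neg _ (by decide : Odd 3)]
    have : ZMod.χ₄ ((3 : ℕ) : ZMod 4) = -1 := by decide
    rw [this, neg_one_mul]
  have hST : charST b c (-s) = (-1) ^ ((v + k) / 2) * charST b c s := by
    rw [charST, charST, kroneckerSym_neg_right _ hs hpos]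
    have hB : 0 < ∏ i, (b i : ℤ) := Finset.prod_pos fun i _ => by exact_mod_cast hb i
    have hC : 0 < ∏ i, (c i : ℤ) := Finset.prod_pos fun i _ => by exact_mod_cast hc i
    have hE : 0 < (if Even v then 4 else 8 : ℤ) := by split_ifs <;> norm_num
    congr 1
    rcases Nat.even_or_odd ((v + k) / 2) with h | h
    · rw [h.neg_one_pow, if_neg]
      have : 0 < 1 * (if Even v then 4 else 8 : ℤ) * (∏ i, (b i : ℤ)) * ∏ i, (c i : ℤ) := by
        positivity
      exact this.le.not_gt
    · rw [h.neg_one_pow, if_pos]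
      have : 0 < (if Even v then 4 else 8 : ℤ) * (∏ i, (b i : ℤ)) * ∏ i, (c i : ℤ) := by
        positivity
      linarith
  rw [charMixed, charMixed, hST, kroneckerSym_three, kroneckerSym_three, h3, pow_add]
  split_ifs with hu
  · rw [hu.neg_one_pow]; ring
  · rw [(Nat.not_even_iff_odd.mp hu).neg_one_pow]; ring

theorem thetaProd_moebius (hvk : Even (v + k)) (ha : ∀ i, 0 < a i) (hb : ∀ i, 0 < b i)
    (hc : ∀ i, 0 < c i) (h8 : 8 ∣ ∑ i, c i) {p q r s : ℤ} (hdet : p * s - q * r = 1)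
    (hr : (level a b c : ℤ) ∣ r) {τ : ℂ} (hτ : 0 < τ.im) :
    thetaProd a b c ((p * τ + q) / (r * τ + s)) =
      charMixed u b c s * (r * τ + s) ^ (u + (v + k) / 2) * thetaProd a b c τ := by
  have hodd : Odd s := odd_of_isCoprime_level (a := a) (b := b) (c := c) (by
    obtain ⟨t, rfl⟩ := hr
    exact ⟨p, -q * t, by rw [← hdet]; ring⟩)
  have hs0 : s ≠ 0 := by rintro rfl; simp at hodd
  rcases lt_or_gt_of_ne hs0 with h | h
  · have := thetaProd_moebius_of_pos hvk ha hb hc h8 (p := -p) (q := -q) (r := -r) (s := -s)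
      (by rw [← hdet]; ring) (by omega) (hr.neg_right) hτ
    have hneg := charMixed_neg (u := u) hb hc hodd.neg (by omega : 0 < -s)
    rw [neg_neg] at hneg
    have e1 : (((-p : ℤ) : ℂ) * τ + ((-q : ℤ) : ℂ)) / (((-r : ℤ) : ℂ) * τ + ((-s : ℤ) : ℂ)) =
        (p * τ + q) / (r * τ + s) := by
      push_cast
      rw [← neg_div_neg_eq]; congr 1 <;> ring
    have e2 : (((-r : ℤ) : ℂ) * τ + ((-s : ℤ) : ℂ)) = -1 * (r * τ + s) := by push_cast; ring
    rw [e1, e2, mul_pow] at this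
    rw [this, hneg, Int.cast_mul, Int.cast_pow, Int.cast_neg, Int.cast_one]
    ring
  · exact thetaProd_moebius_of_pos hvk ha hb hc h8 hdet h hr hτ

theorem genFun_I_ne_zero (ha : ∀ i, 0 < a i) (hb : ∀ i, 0 < b i) (hc : ∀ i, 0 < c i) :
    genFun a b c UpperHalfPlane.I ≠ 0 := by
  obtain ⟨x, hx0, hx⟩ : ∃ x : ℝ, 0 < x ∧ nome UpperHalfPlane.I = x := by
    refine ⟨Real.exp (-2 * Real.pi), Real.exp_pos _, ?_⟩
    rw [nome, Complex.ofReal_exp]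
    congr 1
    push_cast
    linear_combination 2 * Real.pi * Complex.I_sq
  have hs := summable_representations a b c ha hb hc UpperHalfPlane.I
  have e : (fun n : ℕ => ((representations a b c n).ncard : ℂ) * nome UpperHalfPlane.I ^ n) =
      fun n : ℕ => (((representations a b c n).ncard * x ^ n : ℝ) : ℂ) := by
    funext n; rw [hx]; push_cast; rfl
  rw [genFun]
  rw [e] at hs ⊢
  rw [← Complex.ofReal_tsum, Complex.ofReal_ne_zero]
  refine (Summable.tsum_pos (Complex.summable_ofReal.mp hs) (fun n => by positivity) 0 ?_).ne'
  have : 0 < (representations a b c 0).ncard := by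
    rw [Set.ncard_pos (representations_finite a b c ha hb hc 0)]
    exact ⟨(0, 0, 0), by simp [representations, form]⟩
  have : (0 : ℝ) < (representations a b c 0).ncard := by exact_mod_cast this
  simpa using this

theorem twistedGenFun_I_ne_zero (ha : ∀ i, 0 < a i) (hb : ∀ i, 0 < b i) (hc : ∀ i, 0 < c i) :
    twistedGenFun a b c UpperHalfPlane.I ≠ 0 :=
  mul_ne_zero (Complex.exp_ne_zero _) (genFun_I_ne_zero ha hb hc)

theorem thetaProd_I_ne_zero (ha : ∀ i, 0 < a i) (hb : ∀ i, 0 < b i) (hc : ∀ i, 0 < c i) :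
    thetaProd a b c Complex.I ≠ 0 := by
  have := twistedGenFun_I_ne_zero ha hb hc
  rwa [twistedGenFun_eq_thetaProd a b c ha hb hc] at this

theorem charMixed_one : charMixed u b c 1 = 1 := by
  rw [charMixed, charST, kroneckerSym_of_odd _ odd_one, kroneckerSym_three]
  simp

theorem charMixed_mul (u : ℕ) (b : Fin v → ℕ) (c : Fin k → ℕ) {m n : ℤ} (hm : Odd m) (hn : Odd n) :
    charMixed u b c (m * n) = charMixed u b c m * charMixed u b c n := by
  rw [charMixed, charMixed, charMixed, charST, kroneckerSym_mul_right _ hm hn, kroneckerSym_three,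
    jacobiSym.mul_left, kroneckerSym_three, kroneckerSym_three, charST, charST]
  split_ifs <;> ring

theorem charMixed_add_level_mul (hvk : Even (v + k)) (ha : ∀ i, 0 < a i) (hb : ∀ i, 0 < b i)
    (hc : ∀ i, 0 < c i) (h8 : 8 ∣ ∑ i, c i) {d : ℤ} (hd : IsCoprime d (level a b c : ℤ)) (m : ℤ) :
    charMixed u b c (d + level a b c * m) = charMixed u b c d := by
  obtain ⟨p, q, hpq⟩ := hd
  set N := level a b c with hN
  have hI : 0 < Complex.I.im := by simp
  have hIm : 0 < (Complex.I + m).im := by simp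
  have h1 := thetaProd_moebius hvk ha hb hc h8 (p := p) (q := -q) (r := N) (s := d)
    (by rw [← hpq]; ring) (dvd_refl _) hIm
  have h2 := thetaProd_moebius hvk ha hb hc h8 (p := p) (q := -q + p * m) (r := N)
    (s := d + N * m) (by rw [← hpq]; ring) (dvd_refl _) hI
  have h3 := thetaProd_moebius hvk ha hb hc h8 (p := 1) (q := m) (r := 0) (s := 1)
    (by ring) (dvd_zero _) hI
  have h3' : thetaProd a b c (Complex.I + m) = thetaProd a b c Complex.I := by
    simpa [charMixed_one] using h3
  have e1 : (p * (Complex.I + m) + ((-q : ℤ) : ℂ)) / (((N : ℤ) : ℂ) * (Complex.I + m) + d) =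
      (p * Complex.I + ((-q + p * m : ℤ) : ℂ)) /
        (((N : ℤ) : ℂ) * Complex.I + ((d + N * m : ℤ) : ℂ)) := by
    push_cast; congr 1 <;> ring
  have e2 : ((N : ℤ) : ℂ) * (Complex.I + m) + d =
      ((N : ℤ) : ℂ) * Complex.I + ((d + N * m : ℤ) : ℂ) := by push_cast; ring
  rw [e1, h2, e2, h3'] at h1
  have hne : ((N : ℤ) : ℂ) * Complex.I + ((d + N * m : ℤ) : ℂ) ≠ 0 := by
    intro h
    have := congrArg Complex.im h
    simp at this
    exact level_ne_zero ha hb hc this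
  have := mul_right_cancel₀ (pow_ne_zero _ hne)
    (mul_right_cancel₀ (thetaProd_I_ne_zero ha hb hc) h1)
  exact_mod_cast this

theorem charMixed_congr (hvk : Even (v + k)) (ha : ∀ i, 0 < a i) (hb : ∀ i, 0 < b i)
    (hc : ∀ i, 0 < c i) (h8 : 8 ∣ ∑ i, c i) {d e : ℤ} (hd : IsCoprime d (level a b c : ℤ))
    (h : (d : ZMod (level a b c)) = e) : charMixed u b c d = charMixed u b c e := by
  rw [ZMod.intCast_eq_intCast_iff] at h
  obtain ⟨m, hm⟩ := h.dvd
  rw [← charMixed_add_level_mul hvk ha hb hc h8 hd m, ← hm]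
  congr 1; ring

theorem exists_dirichletCharacter_eq_charMixed (hvk : Even (v + k)) (ha : ∀ i, 0 < a i)
    (hb : ∀ i, 0 < b i) (hc : ∀ i, 0 < c i) (h8 : 8 ∣ ∑ i, c i) :
    ∃ ω : DirichletCharacter ℂ (level a b c), ∀ d : ℤ, IsCoprime d (level a b c : ℤ) →
      ω (d : ZMod (level a b c)) = (charMixed u b c d : ℂ) := by
  classical
  have : NeZero (level a b c) := ⟨level_ne_zero ha hb hc⟩
  have hval : ∀ x : ZMod (level a b c), (((x.val : ℤ)) : ZMod (level a b c)) = x := fun x => by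
    rw [Int.cast_natCast, ZMod.natCast_zmod_val]
  have hcop : ∀ {x : ZMod (level a b c)}, IsUnit x → IsCoprime (x.val : ℤ) (level a b c : ℤ) :=
    fun {x} hx => by
      rw [← hval x, ZMod.coe_int_isUnit_iff_isCoprime] at hx
      exact hx.symm
  refine ⟨{ toFun := fun x => if IsUnit x then (charMixed u b c (x.val : ℤ) : ℂ) else 0,
            map_one' := ?_, map_mul' := ?_, map_nonunit' := ?_ }, ?_⟩
  · have h := charMixed_congr (u := u) hvk ha hb hc h8 (hcop isUnit_one) (e := 1)
      (by rw [hval]; simp)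
    simp only [isUnit_one, if_true]
    rw [h, charMixed_one]; simp
  · intro x y
    by_cases hx : IsUnit x
    · by_cases hy : IsUnit y
      · have h := charMixed_congr (u := u) hvk ha hb hc h8 (hcop (hx.mul hy))
          (e := (x.val : ℤ) * (y.val : ℤ)) (by rw [hval, Int.cast_mul, hval, hval])
        simp only [hx, hy, hx.mul hy, if_true]
        rw [h, charMixed_mul u b c (odd_of_isCoprime_level (hcop hx))
          (odd_of_isCoprime_level (hcop hy))]
        push_cast; rfl
      · simp [hy, IsUnit.mul_iff]
    · simp [hx, IsUnit.mul_iff]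
  · intro x hx
    simp [hx]
  · intro d hd
    have hu : IsUnit (d : ZMod (level a b c)) :=
      ZMod.coe_int_isUnit_iff_isCoprime _ _ |>.mpr hd.symm
    change (if IsUnit (d : ZMod (level a b c)) then _ else _) = _
    rw [if_pos hu]
    rw [charMixed_congr (u := u) hvk ha hb hc h8 (hcop hu) (hval _)]

end MixedForm

theorem differentiableAt_thetaTwo {τ : ℂ} (hτ : 0 < τ.im) : DifferentiableAt ℂ thetaTwo τ := by
  have hd : DifferentiableAt ℂ (fun t : ℂ => (t / 2, t)) τ := by fun_prop
  have h := DifferentiableAt.comp (f := fun t : ℂ => (t / 2, t))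
    (g := fun p : ℂ × ℂ => jacobiTheta₂ p.1 p.2) τ
    (hasFDerivAt_jacobiTheta₂ (τ / 2) hτ).differentiableAt hd
  exact DifferentiableAt.mul (by fun_prop) h

theorem differentiableAt_thetaThree {τ : ℂ} (hτ : 0 < τ.im) : DifferentiableAt ℂ thetaThree τ :=
  differentiableAt_jacobiTheta₂_snd 0 hτ

theorem DifferentiableAt.comp_const_mul {f : ℂ → ℂ} {m τ : ℂ} (h : DifferentiableAt ℂ f (m * τ)) :
    DifferentiableAt ℂ (fun t => f (m * t)) τ :=
  DifferentiableAt.comp (g := f) τ h (differentiableAt_id.const_mul m)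

theorem differentiableAt_hexTheta {τ : ℂ} (hτ : 0 < τ.im) : DifferentiableAt ℂ hexTheta τ := by
  have h2 : 0 < (2 * τ).im := by simpa using hτ
  have h6 : 0 < (6 * τ).im := by simpa using hτ
  exact ((differentiableAt_thetaThree h2).comp_const_mul.mul
    (differentiableAt_thetaThree h6).comp_const_mul).add
    ((differentiableAt_thetaTwo h2).comp_const_mul.mul
    (differentiableAt_thetaTwo h6).comp_const_mul)

theorem exists_norm_hexTheta_smul_le : ∃ C : ℝ, 0 ≤ C ∧ ∀ (m : ℕ), 0 < m → ∀ (γ : SL(2, ℤ))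
    (τ : ℍ), 1 ≤ τ.im →
      ‖hexTheta (m * (γ • τ : ℍ))‖ ≤ C * ‖((γ 1 0 : ℤ) * (τ : ℂ) + (γ 1 1 : ℤ))‖ := by
  obtain ⟨C, hC0, hC⟩ := exists_norm_theta_smul_le
  refine ⟨2 * C, by positivity, fun m hm γ τ hτ => ?_⟩
  obtain ⟨p2, p3⟩ := hC (2 * m) (by omega) γ τ hτ
  obtain ⟨q2, q3⟩ := hC (6 * m) (by omega) γ τ hτ
  set j := ‖((γ 1 0 : ℤ) * (τ : ℂ) + (γ 1 1 : ℤ))‖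
  have hj : 0 ≤ C * j := by positivity
  have key : ∀ x y : ℂ, ‖x‖ ^ 2 ≤ C * j → ‖y‖ ^ 2 ≤ C * j → ‖x * y‖ ≤ C * j := fun x y hx hy => by
    rw [norm_mul]; nlinarith [sq_nonneg (‖x‖ - ‖y‖)]
  rw [hexTheta, ← mul_assoc, ← mul_assoc, show (2 * m : ℂ) = (2 * m : ℕ) by push_cast; rfl,
    show (6 * m : ℂ) = (6 * m : ℕ) by push_cast; rfl]
  calc _ ≤ _ := norm_add_le _ _
    _ ≤ C * j + C * j := add_le_add (key _ _ p3 q3) (key _ _ p2 q2)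
    _ = _ := by ring

namespace MixedForm

variable {u v k : ℕ} {a : Fin u → ℕ} {b : Fin v → ℕ} {c : Fin k → ℕ}

theorem mdifferentiable_twistedGenFun (ha : ∀ i, 0 < a i) (hb : ∀ i, 0 < b i)
    (hc : ∀ i, 0 < c i) : MDifferentiable 𝓘(ℂ) 𝓘(ℂ) (twistedGenFun a b c) := by
  rw [UpperHalfPlane.mdifferentiable_iff]
  have h : DifferentiableOn ℂ (thetaProd a b c) {z | 0 < z.im} := by
    intro z hz
    refine DifferentiableAt.differentiableWithinAt (DifferentiableAt.mul (DifferentiableAt.mul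
      (DifferentiableAt.fun_finsetProd fun i _ => ?_)
      (DifferentiableAt.fun_finsetProd fun i _ => ?_))
      (DifferentiableAt.fun_finsetProd fun i _ => ?_))
    · exact (differentiableAt_hexTheta (natCast_mul_im_pos (ha i) hz)).comp_const_mul
    · exact (differentiableAt_thetaThree
        (natCast_mul_im_pos (Nat.mul_pos two_pos (hb i)) hz)).comp_const_mul
    · exact ((differentiableAt_thetaTwo
        (natCast_mul_im_pos (hc i) hz)).comp_const_mul).div_const 2
  refine h.congr fun z hz => ?_
  rw [Function.comp, twistedGenFun_eq_thetaProd a b c ha hb hc, ofComplex_apply_of_im_pos hz]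

theorem isBoundedAtImInfty_twistedGenFun_slash (hvk : Even (v + k)) (ha : ∀ i, 0 < a i)
    (hb : ∀ i, 0 < b i) (hc : ∀ i, 0 < c i) (γ : SL(2, ℤ)) :
    IsBoundedAtImInfty (twistedGenFun a b c ∣[((u + (v + k) / 2 : ℕ) : ℤ)] γ) := by
  obtain ⟨C, hC0, hC⟩ := exists_norm_theta_smul_le
  obtain ⟨D, hD0, hD⟩ := exists_norm_hexTheta_smul_le
  rw [isBoundedAtImInfty_iff]
  refine ⟨D ^ (2 * u) * C ^ v * C ^ k + 1, 1, fun τ hτ => ?_⟩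
  rw [ModularForm.SL_slash_apply, ModularGroup.denom_apply,
    twistedGenFun_eq_thetaProd a b c ha hb hc, norm_mul, norm_zpow, zpow_neg, zpow_natCast]
  have hj : 0 < ‖((γ 1 0 : ℤ) * (τ : ℂ) + (γ 1 1 : ℤ))‖ := norm_pos_iff.mpr (SL_denom_ne_zero γ τ)
  set j := ‖((γ 1 0 : ℤ) * (τ : ℂ) + (γ 1 1 : ℤ))‖
  have h1 : (∏ i, ‖hexTheta (a i * (γ • τ : ℍ))‖) ≤ (D * j) ^ u := by
    rw [← Fin.prod_const]
    exact Finset.prod_le_prod (fun _ _ => norm_nonneg _) fun i _ => hD _ (ha i) γ τ hτ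
  have h2 : (∏ i, ‖thetaThree ((2 * b i : ℕ) * (γ • τ : ℍ))‖) ^ 2 ≤ (C * j) ^ v := by
    rw [← Finset.prod_pow, ← Fin.prod_const]
    exact Finset.prod_le_prod (fun _ _ => by positivity) fun i _ =>
      (hC _ (Nat.mul_pos two_pos (hb i)) γ τ hτ).2
  have h3 : (∏ i, ‖thetaTwo (c i * (γ • τ : ℍ)) / 2‖) ^ 2 ≤ (C * j) ^ k := by
    rw [← Finset.prod_pow, ← Fin.prod_const]
    refine Finset.prod_le_prod (fun _ _ => by positivity) fun i _ => ?_
    have := (hC _ (hc i) γ τ hτ).1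
    rw [norm_div, div_pow]
    refine (div_le_self (by positivity) ?_).trans this
    norm_num
  obtain ⟨w, hw⟩ := hvk
  have hw2 : (v + k) / 2 = w := by omega
  have hsq : ‖thetaProd a b c (γ • τ : ℍ)‖ ^ 2 ≤ D ^ (2 * u) * C ^ v * C ^ k * (j ^ (u + w)) ^ 2 := by
    rw [thetaProd, norm_mul, norm_mul, norm_prod, norm_prod, norm_prod, mul_pow, mul_pow]
    calc _ ≤ ((D * j) ^ u) ^ 2 * (C * j) ^ v * (C * j) ^ k := by gcongr
      _ = D ^ (2 * u) * C ^ v * C ^ k * (j ^ (2 * u) * j ^ (v + k)) := by ring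
      _ = _ := by rw [hw]; ring
  rw [hw2, ← div_eq_mul_inv]
  have hx : (‖thetaProd a b c (γ • τ : ℍ)‖ / j ^ (u + w)) ^ 2 ≤ D ^ (2 * u) * C ^ v * C ^ k := by
    rw [div_pow, div_le_iff₀ (by positivity)]
    exact hsq
  nlinarith [sq_nonneg (‖thetaProd a b c (γ • τ : ℍ)‖ / j ^ (u + w) - 1)]

theorem twistedGenFun_slash (hvk : Even (v + k)) (ha : ∀ i, 0 < a i) (hb : ∀ i, 0 < b i)
    (hc : ∀ i, 0 < c i) (h8 : 8 ∣ ∑ i, c i) {γ : SL(2, ℤ)}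
    (hγ : γ ∈ CongruenceSubgroup.Gamma0 (level a b c)) :
    twistedGenFun a b c ∣[((u + (v + k) / 2 : ℕ) : ℤ)] γ =
      (charMixed u b c (γ 1 1) : ℂ) • twistedGenFun a b c := by
  ext τ
  rw [CongruenceSubgroup.Gamma0_mem, ZMod.intCast_zmod_eq_zero_iff_dvd] at hγ
  rw [ModularForm.SL_slash_apply, ModularGroup.denom_apply, Pi.smul_apply, smul_eq_mul,
    twistedGenFun_eq_thetaProd a b c ha hb hc, twistedGenFun_eq_thetaProd a b c ha hb hc,
    coe_SL_smul, thetaProd_moebius hvk ha hb hc h8 (SL_det γ) hγ τ.im_pos, zpow_neg, zpow_natCast]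
  have := pow_ne_zero (u + (v + k) / 2) (SL_denom_ne_zero γ τ)
  field_simp

theorem isCoprime_of_mem_Gamma0 {N : ℕ} {γ : SL(2, ℤ)} (hγ : γ ∈ CongruenceSubgroup.Gamma0 N) :
    IsCoprime (γ 1 1) (N : ℤ) := by
  rw [CongruenceSubgroup.Gamma0_mem, ZMod.intCast_zmod_eq_zero_iff_dvd] at hγ
  obtain ⟨t, ht⟩ := hγ
  exact ⟨γ 0 0, -γ 0 1 * t, by linear_combination SL_det γ + γ 0 1 * ht⟩

theorem twistedGenFun_add_one (τ σ : ℍ) (h : (σ : ℂ) = τ + 1) :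
    twistedGenFun a b c σ =
      Complex.exp (2 * Real.pi * Complex.I * (((∑ i, c i : ℕ) : ℂ) / 8)) *
        twistedGenFun a b c τ := by
  have hnome : nome σ = nome τ := by
    rw [nome, nome, h, mul_add, mul_one, Complex.exp_periodic]
  rw [twistedGenFun, twistedGenFun, genFun, genFun, hnome, h, mul_add, add_mul, mul_one,
    Complex.exp_add]
  ring

theorem eight_dvd_of_mem (ha : ∀ i, 0 < a i) (hb : ∀ i, 0 < b i) (hc : ∀ i, 0 < c i) {w : ℤ}
    {ω : DirichletCharacter ℂ (level a b c)}
    (h : twistedGenFun a b c ∈ modularFormsWithCharacter (level a b c) w ω) :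
    8 ∣ ∑ i, c i := by
  have hT : ModularGroup.T ∈ CongruenceSubgroup.Gamma0 (level a b c) := by
    rw [CongruenceSubgroup.Gamma0_mem]; simp [ModularGroup.T]
  have h1 := congrFun (h.2.1 _ hT) UpperHalfPlane.I
  have hcoe : ((ModularGroup.T • UpperHalfPlane.I : ℍ) : ℂ) = UpperHalfPlane.I + 1 := by
    rw [modular_T_smul, coe_vadd]; push_cast; ring
  rw [ModularForm.SL_slash_apply, ModularGroup.denom_apply, Pi.smul_apply, smul_eq_mul,
    twistedGenFun_add_one _ _ hcoe] at h1
  simp only [ModularGroup.T, Matrix.of_apply, Matrix.cons_val_one, Matrix.cons_val_zero,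
    Int.cast_zero, zero_mul, Int.cast_one, zero_add, one_zpow, mul_one, map_one, one_mul,
    Matrix.cons_val_fin_one] at h1
  have h2 := mul_right_cancel₀ (twistedGenFun_I_ne_zero ha hb hc) (h1.trans (one_mul _).symm)
  rw [Complex.exp_eq_one_iff] at h2
  obtain ⟨n, hn⟩ := h2
  have hpi : (2 * Real.pi * Complex.I : ℂ) ≠ 0 := Complex.two_pi_I_ne_zero
  have h3 : ((∑ i, c i : ℕ) : ℂ) / 8 = n :=
    mul_left_cancel₀ hpi (hn.trans (mul_comm _ _))
  rw [div_eq_iff (by norm_num)] at h3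
  have h4 : ((∑ i, c i : ℕ) : ℤ) = n * 8 := by exact_mod_cast h3
  omega

end MixedForm

theorem corollary1p4 (u v k : ℕ) (hvk : Even (v + k))
    (a : Fin u → ℕ) (b : Fin v → ℕ) (c : Fin k → ℕ)
    (ha : ∀ i, 0 < a i) (hb : ∀ i, 0 < b i) (hc : ∀ i, 0 < c i) :
    (∀ n : ℕ, (MixedForm.representations a b c n).Finite) ∧
    (∀ τ : ℍ, Summable fun n : ℕ =>
      ((MixedForm.representations a b c n).ncard : ℂ) * MixedForm.nome τ ^ n) ∧
    ((∃ ω : DirichletCharacter ℂ (MixedForm.level a b c),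
        (∀ d : ℤ, IsCoprime d (MixedForm.level a b c : ℤ) →
          ω (d : ZMod (MixedForm.level a b c)) = (MixedForm.charMixed u b c d : ℂ)) ∧
        MixedForm.twistedGenFun a b c ∈
          modularFormsWithCharacter (MixedForm.level a b c) ((u + (v + k) / 2 : ℕ) : ℤ) ω) ↔
      8 ∣ ∑ i, c i) := by
  refine ⟨MixedForm.representations_finite a b c ha hb hc,
    MixedForm.summable_representations a b c ha hb hc, ?_, fun h8 => ?_⟩
  · rintro ⟨ω, -, h⟩
    exact MixedForm.eight_dvd_of_mem ha hb hc h
  · obtain ⟨ω, hω⟩ :=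
      MixedForm.exists_dirichletCharacter_eq_charMixed (u := u) hvk ha hb hc h8
    refine ⟨ω, hω, MixedForm.mdifferentiable_twistedGenFun ha hb hc, fun γ hγ => ?_,
      MixedForm.isBoundedAtImInfty_twistedGenFun_slash hvk ha hb hc⟩
    rw [MixedForm.twistedGenFun_slash hvk ha hb hc h8 hγ,
      hω _ (MixedForm.isCoprime_of_mem_Gamma0 hγ)]
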